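/- For eight planes $f_1=0,\dots,f_8=0$ in $\mathbb P^3_{\mathbb C}$ (homogeneous coordinates $x,y,z,t$), given by their product $F=f_1\cdots f_8$, the \emph{double octic} $X_F$ is a resolution of singularities (for instance a Calabi–Yau one) of the double covering $u^2=F(x,y,z,t)$ of $\mathbb P^3$, or more generally any complex variety birational to this double covering; its holomorphic three-form is, up to scale, $\omega_F=dx\wedge dy\wedge dz/u$ in the chart $t=1$. A \emph{correspondence} between $X_F$ and $X_G$ is a three-dimensional irreducible complex variety $Z$ with dominant rational maps $p:Z\dashrightarrow X_F$ and $q:Z\dashrightarrow X_G$ such that $p^*\omega_F=c\,q^*\omega_G$ for a constant $c\in\mathbb C^*$ (so the closure of the image of $Z$ in $X_F\times X_G$ is a cycle of dimension three that identifies the spaces $H^{3,0}$ of smooth projective models). Consider the following arrangements (numbers as in C. Meyer's list). Rigid ones: - 1: $xyzt(x+y)(y+z)(z+t)(x+t)$; - 32: $xyzt(x+y)(y+z)(x-y-z-t)(x+y-z+t)$; - 93: $xyzt(x+y)(x-y+z)(y-z-t)(x+z-t)$; - 238: $xyzt(x+y+z-t)(x+y-z+t)(x-y+z+t)(-x+y+z+t)$;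 - 240: $xyzt(x+y+z)(x+y-z+t)(x-y+z+t)(x-y-z-t)$; - 241: $xyzt(x+y+z+t)(x+y-z-t)(y-z+t)(x+z-t)$; - 245: $xyzt(x+y+z)(y+z+t)(x-y-t)(x-y+z+t)$. One-parameter families, with parameter $(A:B)\in\mathbb P^1(\mathbb C)$ outside the listed special values of $A/B$, at which the arrangement acquires further incidences: - 2: $xyzt(x+y)(y+z)(z+t)(Ax+Bt)$, $A/B\ne\infty,0,1$; - 8: $xyzt(x+y)(y+z)(z-t)(Ax-By-Bz+Bt)$, $A/B\neq\infty,0,-1$; - 10: $xyzt(x+y)(y+z)(z-t)(Ax-By-Bz-At)$, $A/B\neq\infty,0,-1$; - 242: $xyzt(x+y+z)(x+z-t)(Ax+(A+B)y-Bz+Bt)((A+B)x+(A+B)y+Bt)$, $A/B\neq\infty,0,-1,-2$; - 247: $xyzt(x+y+z)(y+z+t)(x-y-t)(Ax-Bz+Bt)$, $A/B\neq\infty,0,-1,-2$; - 249: $xyzt(x+y+z)(x+z+t)(Ax+(A+B)y-Bz+At)(By-Bz+At)$, $A/B\neq\infty,0,-1,-2$; - 252: $xyzt(x+y+z)(x+y+t)(Ax+2Ay-Bz+At)(Ax-Bz-At)$,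 $A/B\neq\infty,0,-1,-\tfrac12$. Theorem. There exist correspondences between the following pairs of double octics: $$(1,238),\ (32,93),\ (238,241),\ (240,245),\ (2,242),\ (8,249),\ (10,242),\ (247,252).$$ For the last four pairs, which are pairs of one-parameter families, this means: for every non-special member of either family there is a non-special member of the other family and a correspondence between the two. -/

import Mathlib

open CategoryTheory AlgebraicGeometry

noncomputable section

namespace DoubleOctic

/-- Eight planes in `ℙ³` over `ℂ`: the `i`-th plane is
`D i 0 * x + D i 1 * y + D i 2 * z + D i 3 * t = 0`. -/
abbrev Arrangement : Type := Fin 8 → Fin 4 → ℂ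

/-- The linear form with coefficients `a`, restricted to the affine chart `t = 1` of `ℙ³`,
as a polynomial in the affine coordinates `x, y, z`. -/
def affineForm (a : Fin 4 → ℂ) : MvPolynomial (Fin 3) ℂ :=
  MvPolynomial.C (a 0) * MvPolynomial.X 0 + MvPolynomial.C (a 1) * MvPolynomial.X 1 +
    MvPolynomial.C (a 2) * MvPolynomial.X 2 + MvPolynomial.C (a 3)

/-- The equation `f(x, y, z) = ∏ fᵢ(x, y, z, 1)` of the octic surface in the chart `t = 1`. -/
def branchPolynomial (D : Arrangement) : MvPolynomial (Fin 3) ℂ :=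
  ∏ i, affineForm (D i)

/-- The coordinate ring `ℂ[x, y, z, u] / (u² - f)` of the part over `t = 1` of the double covering
of `ℙ³` branched along the eight planes. -/
abbrev CoverRing (D : Arrangement) : Type :=
  AdjoinRoot (Polynomial.X ^ 2 - Polynomial.C (branchPolynomial D))

/-- The coordinates `x, y, z` on the double covering. -/
def coord (D : Arrangement) (i : Fin 3) : CoverRing D :=
  AdjoinRoot.of _ (MvPolynomial.X i)

/-- The coordinate `u` on the double covering, `u² = f(x, y, z)`. -/
def coverRoot (D : Arrangement) : CoverRing D :=
  AdjoinRoot.root _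

/-- The base scheme `Spec ℂ`. -/
abbrev SpecC : Scheme.{0} := Spec (CommRingCat.of ℂ)

/-- The (dense, affine) part over `t = 1` of the double covering of `ℙ³` branched along `D`. -/
abbrev cover (D : Arrangement) : Scheme.{0} := Spec (CommRingCat.of (CoverRing D))

/-- The structure morphism of the double covering. -/
abbrev coverStr (D : Arrangement) : cover D ⟶ SpecC :=
  Spec.map (CommRingCat.ofHom (algebraMap ℂ (CoverRing D)))

/-- A birational model of the double octic of `D`: a complex variety `X` with a birational
map to the double covering of `ℙ³` branched along `D`. The double covering itself, and all its
resolutions of singularities, the Calabi-Yau ones in particular, are models. -/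
structure Model (D : Arrangement) where
  /-- the variety -/
  X : Scheme.{0}
  /-- its structure morphism -/
  str : X ⟶ SpecC
  integral : IsIntegral X
  finiteType : LocallyOfFiniteType str
  quasiCompact : QuasiCompact str
  separated : IsSeparated str
  /-- the birational map to the double covering -/
  birat : X.PartialIso (cover D)
  birat_over : birat.IsOver str (coverStr D)

attribute [instance] Model.integral Model.finiteType Model.quasiCompact Model.separated

/-- The pull-back `dx ∧ dy ∧ dz / u`, along a `K`-valued point `ψ` of the double covering, of the
holomorphic three-form of the double octic: a Kähler three-form of the field `K` over `ℂ`. -/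
def threeForm (D : Arrangement) (K : Type) [Field K] [Algebra ℂ K] (ψ : CoverRing D →+* K) :
    ⋀[K]^3 (Ω[K⁄ℂ]) :=
  (ψ (coverRoot D))⁻¹ •
    exteriorPower.ιMulti K 3 (fun i : Fin 3 => KaehlerDifferential.D ℂ K (ψ (coord D i)))

section FunctionField

variable (Z : Scheme.{0}) [IsIntegral Z]

/-- The structure of a `ℂ`-algebra on the function field of a variety over `ℂ`. -/
abbrev functionFieldAlgebra (sZ : Z ⟶ SpecC) : Algebra ℂ Z.functionField :=
  (Spec.preimage (Z.fromSpecStalk (genericPoint Z) ≫ sZ)).hom.toAlgebra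

end FunctionField

/-- The ring homomorphism from the coordinate ring of the double covering to the function field of
`Z` (substitution of the coordinate functions) that a rational map `Z ⤏ cover D` induces. -/
def pullbackHom {Z : Scheme.{0}} [IsIntegral Z] {D : Arrangement} (h : Z ⤏ cover D) :
    CoverRing D →+* Z.functionField :=
  (Spec.preimage h.fromFunctionField).hom

/-- A correspondence between two models: a three-dimensional complex variety `Z` with dominant
(hence generically finite) rational maps `p : Z ⤏ X` and `q : Z ⤏ Y` over `ℂ`, so that
the closure of the image of `Z` in `X × Y` is a three-dimensional cycle dominating both factors,
such that `p` and `q` identify, up to a non-zero constant, the holomorphic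
three-forms of the two double octics. -/
def HasCorrespondence {D E : Arrangement} (X : Model D) (Y : Model E) : Prop :=
  ∃ (Z : Scheme.{0}) (sZ : Z ⟶ SpecC) (_ : IsIntegral Z) (_ : LocallyOfFiniteType sZ)
    (_ : QuasiCompact sZ) (_ : IsSeparated sZ)
    (p : Z ⤏ X.X) (q : Z ⤏ Y.X) (_ : p.IsDominant) (_ : q.IsDominant),
    p.compHom X.str = sZ.toRationalMap ∧ q.compHom Y.str = sZ.toRationalMap ∧
    letI : Algebra ℂ Z.functionField := functionFieldAlgebra Z sZ
    Algebra.trdeg ℂ Z.functionField = 3 ∧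
    ∃ c : ℂ, c ≠ 0 ∧
      threeForm D Z.functionField (pullbackHom (p.comp X.birat.toRationalMap)) =
        algebraMap ℂ Z.functionField c •
          threeForm E Z.functionField (pullbackHom (q.comp Y.birat.toRationalMap))

/-- There is a correspondence between the double octics of `D` and `E`, on whichever models. -/
def Correspond (D E : Arrangement) : Prop :=
  ∀ (X : Model D) (Y : Model E), HasCorrespondence X Y

/-- The same for one-parameter families with parameter `(A : B)`, the predicates `P`, `Q` telling
which parameters are non-special: every non-special member of either family has a correspondence
with some non-special member of the other. -/
def FamiliesCorrespond (P : ℂ → ℂ → Prop) (D : ℂ → ℂ → Arrangement)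
    (Q : ℂ → ℂ → Prop) (E : ℂ → ℂ → Arrangement) : Prop :=
  (∀ A B, P A B → ∃ A' B', Q A' B' ∧ Correspond (D A B) (E A' B')) ∧
  (∀ A' B', Q A' B' → ∃ A B, P A B ∧ Correspond (D A B) (E A' B'))

/-! Rigid arrangements. The rows are the coefficients of `x, y, z, t`. -/

/-- Arrangement no. 1. -/
def arr1 : Arrangement :=
  ![![1, 0, 0, 0], ![0, 1, 0, 0], ![0, 0, 1, 0], ![0, 0, 0, 1],
    ![1, 1, 0, 0], ![0, 1, 1, 0], ![0, 0, 1, 1], ![1, 0, 0, 1]]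

/-- Arrangement no. 32. -/
def arr32 : Arrangement :=
  ![![1, 0, 0, 0], ![0, 1, 0, 0], ![0, 0, 1, 0], ![0, 0, 0, 1],
    ![1, 1, 0, 0], ![0, 1, 1, 0], ![1, -1, -1, -1], ![1, 1, -1, 1]]

/-- Arrangement no. 93. -/
def arr93 : Arrangement :=
  ![![1, 0, 0, 0], ![0, 1, 0, 0], ![0, 0, 1, 0], ![0, 0, 0, 1],
    ![1, 1, 0, 0], ![1, -1, 1, 0], ![0, 1, -1, -1], ![1, 0, 1, -1]]

/-- Arrangement no. 238. -/
def arr238 : Arrangement :=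
  ![![1, 0, 0, 0], ![0, 1, 0, 0], ![0, 0, 1, 0], ![0, 0, 0, 1],
    ![1, 1, 1, -1], ![1, 1, -1, 1], ![1, -1, 1, 1], ![-1, 1, 1, 1]]

/-- Arrangement no. 240. -/
def arr240 : Arrangement :=
  ![![1, 0, 0, 0], ![0, 1, 0, 0], ![0, 0, 1, 0], ![0, 0, 0, 1],
    ![1, 1, 1, 0], ![1, 1, -1, 1], ![1, -1, 1, 1], ![1, -1, -1, -1]]

/-- Arrangement no. 241. -/
def arr241 : Arrangement :=
  ![![1, 0, 0, 0], ![0, 1, 0, 0], ![0, 0, 1, 0], ![0, 0, 0, 1],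
    ![1, 1, 1, 1], ![1, 1, -1, -1], ![0, 1, -1, 1], ![1, 0, 1, -1]]

/-- Arrangement no. 245. -/
def arr245 : Arrangement :=
  ![![1, 0, 0, 0], ![0, 1, 0, 0], ![0, 0, 1, 0], ![0, 0, 0, 1],
    ![1, 1, 1, 0], ![0, 1, 1, 1], ![1, -1, 0, -1], ![1, -1, 1, 1]]

/-! One-parameter families of arrangements with parameter `(A : B)`. A parameter is non-special if
the arrangement has no more incidences than the generic member of the family, i.e. every
`4 × 4` minor of the coefficients that is not identically zero is non-zero. -/

/-- Arrangements no. 2; special for `A : B = ∞, 0, 1`. -/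
def arr2 (A B : ℂ) : Arrangement :=
  ![![1, 0, 0, 0], ![0, 1, 0, 0], ![0, 0, 1, 0], ![0, 0, 0, 1],
    ![1, 1, 0, 0], ![0, 1, 1, 0], ![0, 0, 1, 1], ![A, 0, 0, B]]

/-- The non-special parameters for no. 2. -/
def nonspecial2 (A B : ℂ) : Prop := B ≠ 0 ∧ A ≠ 0 ∧ A ≠ B

/-- Arrangements no. 8; special for `A : B = ∞, 0, -1`. -/
def arr8 (A B : ℂ) : Arrangement :=
  ![![1, 0, 0, 0], ![0, 1, 0, 0], ![0, 0, 1, 0], ![0, 0, 0, 1],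
    ![1, 1, 0, 0], ![0, 1, 1, 0], ![0, 0, 1, -1], ![A, -B, -B, B]]

/-- The non-special parameters for no. 8. -/
def nonspecial8 (A B : ℂ) : Prop := B ≠ 0 ∧ A ≠ 0 ∧ A ≠ -B

/-- Arrangements no. 10; special for `A : B = ∞, 0, -1`. -/
def arr10 (A B : ℂ) : Arrangement :=
  ![![1, 0, 0, 0], ![0, 1, 0, 0], ![0, 0, 1, 0], ![0, 0, 0, 1],
    ![1, 1, 0, 0], ![0, 1, 1, 0], ![0, 0, 1, -1], ![A, -B, -B, -A]]

/-- The non-special parameters for no. 10. -/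
def nonspecial10 (A B : ℂ) : Prop := B ≠ 0 ∧ A ≠ 0 ∧ A ≠ -B

/-- Arrangements no. 242; special for `A : B = ∞, 0, -1, -2`. -/
def arr242 (A B : ℂ) : Arrangement :=
  ![![1, 0, 0, 0], ![0, 1, 0, 0], ![0, 0, 1, 0], ![0, 0, 0, 1],
    ![1, 1, 1, 0], ![1, 0, 1, -1], ![A, A + B, -B, B], ![A + B, A + B, 0, B]]

/-- The non-special parameters for no. 242. -/
def nonspecial242 (A B : ℂ) : Prop := B ≠ 0 ∧ A ≠ 0 ∧ A ≠ -B ∧ A ≠ -2 * B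

/-- Arrangements no. 247; special for `A : B = ∞, 0, -1, -2`. -/
def arr247 (A B : ℂ) : Arrangement :=
  ![![1, 0, 0, 0], ![0, 1, 0, 0], ![0, 0, 1, 0], ![0, 0, 0, 1],
    ![1, 1, 1, 0], ![0, 1, 1, 1], ![1, -1, 0, -1], ![A, 0, -B, B]]

/-- The non-special parameters for no. 247. -/
def nonspecial247 (A B : ℂ) : Prop := B ≠ 0 ∧ A ≠ 0 ∧ A ≠ -B ∧ A ≠ -2 * B

/-- Arrangements no. 249; special for `A : B = ∞, 0, -1, -2`. -/
def arr249 (A B : ℂ) : Arrangement :=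
  ![![1, 0, 0, 0], ![0, 1, 0, 0], ![0, 0, 1, 0], ![0, 0, 0, 1],
    ![1, 1, 1, 0], ![1, 0, 1, 1], ![A, A + B, -B, A], ![0, B, -B, A]]

/-- The non-special parameters for no. 249. -/
def nonspecial249 (A B : ℂ) : Prop := B ≠ 0 ∧ A ≠ 0 ∧ A ≠ -B ∧ A ≠ -2 * B

/-- Arrangements no. 252; special for `A : B = ∞, 0, -1, -1/2`. -/
def arr252 (A B : ℂ) : Arrangement :=
  ![![1, 0, 0, 0], ![0, 1, 0, 0], ![0, 0, 1, 0], ![0, 0, 0, 1],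
    ![1, 1, 1, 0], ![1, 1, 0, 1], ![A, 2 * A, -B, A], ![A, 0, -B, -A]]

/-- The non-special parameters for no. 252. -/
def nonspecial252 (A B : ℂ) : Prop := B ≠ 0 ∧ A ≠ 0 ∧ A ≠ -B ∧ 2 * A ≠ -B

end DoubleOctic

end

/-!
In each of these arrangements four of the eight planes pass through one point and the other four
through another one, so in coordinates `l, a, b` that depend linearly on `x, y, z, t` the equation
reads `u² = p(l, a) q(l, b)`, and `ω = dl ∧ da ∧ db / u` up to a constant. The double octic is
thus, birationally, the quotient by `(v, w) ↦ (-v, -w)` of the fibre product over the `l`-line of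
the two families of curves of genus one `v² = p(l, a)` and `w² = q(l, b)`, with `u = v w`. A
correspondence of two double octics comes from a covering of the base line and from maps between
the fibres which respect the relative differentials `da / v`, `db / w` up to constants. The maps
used on the fibres are the two-isogeny from `v² = (r² - 1)(r² - m²)` to
`z² = (s² - (m + 1)²)(s² - (m - 1)²)` (`exists_landen`), the one given by `r ↦ r²`, and projective
changes of the coordinate; the base is covered twice, by `l ↦ l²`, `l ↦ (l - 1)² / (4 l)` or
`l ↦ (l - 1)(l + c) / c`, in the pairs that involve nos. 1, 2, 8 and 10.

The correspondence itself is a model of `L = ℂ(l, r, s)(v, w)`, where `v²` and `w²` are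
polynomials, and both double coverings receive explicit `L`-valued points. By
`isPullback_of_homogeneous` and `volumeForm_of_hasRelDeriv` the pull-backs of the two three-forms
to `L` are multiples of `dl ∧ dr ∧ ds`, and one compares the factors. A point with non-zero
pull-back is generic: its coordinates are algebraically independent, by
`isTranscendenceBasis_of_volumeForm_ne_zero`, and the branch octic is not a square, so the
coordinate ring of the covering embeds into `L` (`injective_of_algebraicIndependent`). Finally `L`
is the fraction field of a finitely generated algebra `S` which contains both coordinate rings, and
`Spec S` is the variety sought (`correspond_of_field`). -/

noncomputable section

namespace DoubleOctic

/-! ### Dominant morphisms and rational maps -/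

lemma isDominant_specMap {R S : CommRingCat.{0}} (f : R ⟶ S)
    (hf : Function.Injective f.hom) : IsDominant (Spec.map f) := by
  refine ⟨?_⟩
  have := (PrimeSpectrum.denseRange_comap_iff_ker_le_nilRadical f.hom).2 (by
    rw [(RingHom.injective_iff_ker_eq_bot _).1 hf]; exact bot_le)
  exact this

/-- If `p` takes values in the domain of `g`, the composition of partial maps needs no shrinking of
the domain of `p`. -/
lemma partialMap_comp_equiv_of_factor {X Y Z : Scheme.{0}} [PreirreducibleSpace X] [Nonempty Y]
    (p : X.PartialMap Y) [IsDominant p.hom] (g : Y.PartialMap Z)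
    (e : (p.domain : Scheme.{0}) ⟶ g.domain) (he : e ≫ g.domain.ι = p.hom) :
    (p.comp g).equiv ⟨p.domain, p.dense_domain, e ≫ g.hom⟩ := by
  have key : p.hom ∣_ g.domain = (p.hom ⁻¹ᵁ g.domain).ι ≫ e := by
    rw [← cancel_mono g.domain.ι, morphismRestrict_ι, Category.assoc, he]
  set W : X.Opens := p.domain.ι ''ᵁ p.hom ⁻¹ᵁ g.domain
  have hle : W ≤ p.domain := (Set.image_subset_range _ _).trans_eq Subtype.range_val
  have hι : (p.domain.ι.isoImage (p.hom ⁻¹ᵁ g.domain)).inv ≫ (p.hom ⁻¹ᵁ g.domain).ι =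
      X.homOfLE hle := by
    rw [← cancel_mono p.domain.ι, Category.assoc, Scheme.Hom.isoImage_inv_ι]
    simp only [Scheme.homOfLE_ι]
    rfl
  refine ⟨W, (p.comp g).dense_domain, le_rfl, hle, ?_⟩
  change X.homOfLE (le_refl W) ≫ (p.domain.ι.isoImage (p.hom ⁻¹ᵁ g.domain)).inv ≫
    p.hom ∣_ g.domain ≫ g.hom = X.homOfLE hle ≫ e ≫ g.hom
  rw [key, ← hι]
  simp

section PartialIso

variable {X Y S : Scheme.{0}} (f : X.PartialIso Y)

instance : IsDominant f.toPartialMap.hom := by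
  have : IsDominant f.target.ι := Opens.isDominant_ι f.dense_target
  change IsDominant (f.iso.hom ≫ f.target.ι)
  infer_instance

lemma partialIso_symm_compHom {sX : X ⟶ S} {sY : Y ⟶ S} (hf : f.IsOver sX sY) :
    f.symm.toRationalMap.compHom sX = sY.toRationalMap := by
  rw [← Scheme.RationalMap.compHom_toRationalMap, Scheme.PartialMap.toRationalMap_eq_iff]
  refine ⟨f.target, f.dense_target, le_rfl, le_top, ?_⟩
  change Y.homOfLE (le_refl f.target) ≫ (f.iso.inv ≫ f.source.ι) ≫ sX =
    Y.homOfLE le_top ≫ Y.topIso.hom ≫ sY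
  have h : f.iso.inv ≫ f.source.ι ≫ sX = f.target.ι ≫ sY := hf.symm
  simp [h]

lemma partialIso_symm_comp_self [IrreducibleSpace Y] [Nonempty X] :
    f.symm.toRationalMap.comp f.toRationalMap = Scheme.RationalMap.id Y := by
  rw [Scheme.RationalMap.toRationalMap_comp, Scheme.RationalMap.id,
    Scheme.PartialMap.toRationalMap_eq_iff]
  refine (partialMap_comp_equiv_of_factor f.symm.toPartialMap f.toPartialMap f.iso.inv rfl).trans ?_
  refine ⟨f.target, f.dense_target, le_rfl, le_top, ?_⟩
  change Y.homOfLE (le_refl f.target) ≫ f.iso.inv ≫ f.iso.hom ≫ f.target.ι =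
    Y.homOfLE le_top ≫ Y.topIso.hom ≫ 𝟙 Y
  simp

end PartialIso

lemma fromFunctionField_toRationalMap_spec {R : CommRingCat.{0}} [IsDomain R] {Y : Scheme.{0}}
    (f : Spec R ⟶ Y) : f.toRationalMap.fromFunctionField =
      Spec.map (CommRingCat.ofHom (algebraMap R (Spec R).functionField)) ≫ f := by
  rw [Scheme.RationalMap.fromFunctionField_toRationalMap]
  refine (Scheme.PartialMap.fromSpecStalkOfMem_toPartialMap f _).trans ?_
  congr 1
  exact Spec.fromSpecStalk_eq _ _

/-! ### From an inclusion of coordinate rings to a correspondence -/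

section ThreeForm

variable {L F : Type} [Field L] [Field F] [Algebra ℂ L] [Algebra ℂ F]

/-- An identity of pull-backs of the three-forms persists under an extension of the field. -/
lemma threeForm_eq_smul_of_algHom (e : L →ₐ[ℂ] F) {D E : Arrangement}
    {φ : CoverRing D →+* L} {ψ : CoverRing E →+* L} {a : L}
    (h : threeForm D L φ = a • threeForm E L ψ) :
    threeForm D F (e.toRingHom.comp φ) = e a • threeForm E F (e.toRingHom.comp ψ) := by
  let _ : Algebra L F := e.toRingHom.toAlgebra
  have : IsScalarTower ℂ L F := IsScalarTower.of_algebraMap_eq' e.comp_algebraMap.symm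
  let m : Ω[F⁄ℂ] [⋀^Fin 3]→ₗ[L] ⋀[F]^3 Ω[F⁄ℂ] :=
    { (exteriorPower.ιMulti F 3).toMultilinearMap.restrictScalars L with
      map_eq_zero_of_eq' := (exteriorPower.ιMulti F 3).map_eq_zero_of_eq' }
  let T := exteriorPower.alternatingMapLinearEquiv
    (m.compLinearMap (KaehlerDifferential.map ℂ ℂ L F))
  have key : ∀ (G : Arrangement) (χ : CoverRing G →+* L),
      T (threeForm G L χ) = threeForm G F (e.toRingHom.comp χ) := by
    intro G χ
    rw [threeForm, map_smul, exteriorPower.alternatingMapLinearEquiv_apply_ιMulti, threeForm,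
      algebra_compatible_smul F (χ (coverRoot G))⁻¹, map_inv₀]
    congr 1
    change exteriorPower.ιMulti F 3 _ = _
    congr 1
    funext i
    exact KaehlerDifferential.map_D ℂ ℂ L F _
  rw [← key, ← key, h, map_smul, algebra_compatible_smul F a]
  rfl

end ThreeForm

section Domain

variable (S : CommRingCat.{0}) [IsDomain S] [Algebra ℂ S]

/-- The `ℂ`-algebra structure of the function field of the affine scheme of `S` is the one
it has as the fraction field of `S`. -/
lemma algebraMap_functionFieldAlgebra :
    @algebraMap ℂ (Spec S).functionField _ _
      (functionFieldAlgebra _ (Spec.map (CommRingCat.ofHom (algebraMap ℂ S)))) =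
    (algebraMap S (Spec S).functionField).comp
      (algebraMap ℂ S) := by
  have h : (Spec S).fromSpecStalk (genericPoint (Spec S)) =
      Spec.map (CommRingCat.ofHom (algebraMap S (Spec S).functionField)) :=
    Spec.fromSpecStalk_eq _ _
  change (Spec.preimage (_ ≫ _)).hom = _
  rw [h, ← Spec.map_comp, Spec.preimage_map]
  rfl

variable {S}

/-- Two embeddings of the coordinate rings of the double coverings into a finitely generated domain
`S` of dimension three, which identify the three-forms, make `Spec S` a correspondence: they give
dominant morphisms to the double coverings, which are followed by the inverses of the birational
maps from the models. -/
theorem correspond_of_isFractionRing [Algebra.FiniteType ℂ S] {L : Type} [Field L] [Algebra ℂ L]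
    [Algebra S L] [IsScalarTower ℂ S L] [IsFractionRing S L] (hL : Algebra.trdeg ℂ L = 3)
    {D E : Arrangement} (φ : CoverRing D →ₐ[ℂ] S) (ψ : CoverRing E →ₐ[ℂ] S)
    (hφ : Function.Injective φ) (hψ : Function.Injective ψ) {c : ℂ} (hc : c ≠ 0)
    (h : threeForm D L ((algebraMap S L).comp φ) =
      algebraMap ℂ L c • threeForm E L ((algebraMap S L).comp ψ)) :
    Correspond D E := by
  intro X Y
  let Z : Scheme.{0} := Spec S
  let sZ : Z ⟶ SpecC := Spec.map (CommRingCat.ofHom (algebraMap ℂ S))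
  -- the dominant morphism to a double covering, and the rational map to its model
  have main : ∀ (G : Arrangement) (W : Model G) (χ : CoverRing G →ₐ[ℂ] S),
      Function.Injective χ → ∃ (r : Z ⤏ W.X) (_ : r.IsDominant),
        r.compHom W.str = sZ.toRationalMap ∧
        pullbackHom (r.comp W.birat.toRationalMap) =
          (algebraMap S Z.functionField).comp χ.toRingHom := by
    intro G W χ hχ
    have : IsDomain (CoverRing G) := hχ.isDomain χ.toRingHom
    let f : Z ⟶ cover G := Spec.map (CommRingCat.ofHom χ.toRingHom)
    have : IsDominant f := isDominant_specMap _ hχ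
    have : Nonempty W.X := inferInstance
    refine ⟨f.toRationalMap.comp W.birat.symm.toRationalMap, inferInstance, ?_, ?_⟩
    · rw [← Scheme.RationalMap.comp_toRationalMap, Scheme.RationalMap.comp_assoc,
        Scheme.RationalMap.comp_toRationalMap, partialIso_symm_compHom _ W.birat_over,
        Scheme.RationalMap.comp_toRationalMap, ← Scheme.RationalMap.compHom_toRationalMap,
        Scheme.Hom.toPartialMap_compHom]
      congr 2
      rw [← Spec.map_comp, ← CommRingCat.ofHom_comp]
      congr 2
      exact χ.comp_algebraMap
    · rw [Scheme.RationalMap.comp_assoc, partialIso_symm_comp_self, Scheme.RationalMap.comp_id,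
        pullbackHom, fromFunctionField_toRationalMap_spec, ← Spec.map_comp, Spec.preimage_map]
      rfl
  obtain ⟨p, hp, hp1, hp2⟩ := main D X φ hφ
  obtain ⟨q, hq, hq1, hq2⟩ := main E Y ψ hψ
  have hfin : LocallyOfFiniteType sZ := by
    rw [HasRingHomProperty.Spec_iff (P := @LocallyOfFiniteType)]
    exact RingHom.finiteType_algebraMap.2 inferInstance
  refine ⟨Z, sZ, inferInstance, hfin, inferInstance, inferInstance, p, q, hp, hq, hp1, hq1, ?_⟩
  let _ : Algebra ℂ Z.functionField := functionFieldAlgebra Z sZ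
  have : IsFractionRing S Z.functionField :=
    functionField_isFractionRing_of_affine S
  have : IsScalarTower ℂ S Z.functionField :=
    IsScalarTower.of_algebraMap_eq' (algebraMap_functionFieldAlgebra S)
  let e : L ≃ₐ[ℂ] Z.functionField :=
    (IsLocalization.algEquiv (nonZeroDivisors S) L Z.functionField).restrictScalars ℂ
  refine ⟨e.trdeg_eq.symm.trans hL, c, hc, ?_⟩
  have he : e.toAlgHom.toRingHom.comp (algebraMap S L) = algebraMap S Z.functionField :=
    RingHom.ext fun s =>
      (IsLocalization.algEquiv (nonZeroDivisors S) L Z.functionField).commutes s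
  have h' := threeForm_eq_smul_of_algHom e.toAlgHom h
  rw [← RingHom.comp_assoc, ← RingHom.comp_assoc, he] at h'
  rw [hp2, hq2]
  refine h'.trans ?_
  congr 1
  exact e.commutes c

end Domain

section FunctionFieldCriterion

open scoped IntermediateField.algebraAdjoinAdjoin

instance (D : Arrangement) : Algebra.FiniteType ℂ (CoverRing D) :=
  .of_surjective (AdjoinRoot.mkₐ (R := MvPolynomial (Fin 3) ℂ)
    (Polynomial.X ^ 2 - Polynomial.C (branchPolynomial D)) |>.restrictScalars ℂ)
    AdjoinRoot.mk_surjective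

lemma fg_range {R A B : Type*} [CommRing R] [CommRing A] [CommRing B] [Algebra R A] [Algebra R B]
    [Algebra.FiniteType R A] (f : A →ₐ[R] B) : f.range.FG :=
  f.range.fg_iff_finiteType.2 (.of_surjective f.rangeRestrict f.rangeRestrict_surjective)

/-- It suffices to embed the coordinate rings of the double coverings into a function field `L` of
transcendence degree three: `L` is the fraction field of a finitely generated algebra that contains
both images. -/
theorem correspond_of_field {L : Type} [Field L] [Algebra ℂ L] [Algebra.EssFiniteType ℂ L]
    (hL : Algebra.trdeg ℂ L = 3) {D E : Arrangement}
    (φ : CoverRing D →ₐ[ℂ] L) (ψ : CoverRing E →ₐ[ℂ] L)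
    (hφ : Function.Injective φ) (hψ : Function.Injective ψ) {c : ℂ} (hc : c ≠ 0)
    (h : threeForm D L φ.toRingHom = algebraMap ℂ L c • threeForm E L ψ.toRingHom) :
    Correspond D E := by
  obtain ⟨s, hs⟩ := IntermediateField.fg_top_iff.2 ‹Algebra.EssFiniteType ℂ L›
  let S : Subalgebra ℂ L := Algebra.adjoin ℂ (s : Set L) ⊔ (φ.range ⊔ ψ.range)
  have hS : S.FG := (Subalgebra.fg_adjoin_finset s).sup
    ((fg_range φ).sup (fg_range ψ))
  have : Algebra.FiniteType ℂ S := S.fg_iff_finiteType.1 hS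
  have : IsFractionRing S L := .of_field _ _ fun z => by
    obtain ⟨x, hx, y, hy, e⟩ := IntermediateField.mem_adjoin_iff_div.1
      (hs ▸ IntermediateField.mem_top : z ∈ IntermediateField.adjoin ℂ (s : Set L))
    exact ⟨⟨x, le_sup_left (a := Algebra.adjoin ℂ (s : Set L)) hx⟩,
      ⟨y, le_sup_left (a := Algebra.adjoin ℂ (s : Set L)) hy⟩, e⟩
  let φ' : CoverRing D →ₐ[ℂ] S := φ.codRestrict S fun x =>
    (le_sup_left.trans le_sup_right : φ.range ≤ S) ⟨x, rfl⟩
  let ψ' : CoverRing E →ₐ[ℂ] S := ψ.codRestrict S fun x =>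
    (le_sup_right.trans le_sup_right : ψ.range ≤ S) ⟨x, rfl⟩
  exact correspond_of_isFractionRing (S := CommRingCat.of S) hL φ' ψ'
    (fun a b e => hφ congr(($e : L))) (fun a b e => hψ congr(($e : L))) hc h

end FunctionFieldCriterion

/-! ### Kähler three-forms and transcendence bases -/

section VolumeForm

open scoped IntermediateField.algebraAdjoinAdjoin

/-- The Kähler three-form `dt₀ ∧ dt₁ ∧ dt₂`. -/
def volumeForm {L : Type} [Field L] [Algebra ℂ L] (t : Fin 3 → L) : ⋀[L]^3 (Ω[L⁄ℂ]) :=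
  exteriorPower.ιMulti L 3 (fun i => KaehlerDifferential.D ℂ L (t i))

lemma alternatingMap_sum_smul {K M N : Type*} [Field K] [AddCommGroup M] [Module K M]
    [AddCommGroup N] [Module K N] {n : ℕ} (f : M [⋀^Fin n]→ₗ[K] N) (v : Fin n → M)
    (A : Matrix (Fin n) (Fin n) K) : f (fun i => ∑ j, A i j • v j) = A.det • f v := by
  let b := Pi.basisFun K (Fin n)
  let g := f.compLinearMap (Fintype.linearCombination K v)
  have hg : g b = f v := by
    simp only [g, AlternatingMap.compLinearMap_apply]
    congr 1; funext i; simp [b]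
  have key : g = (LinearMap.toSpanSingleton K N (f v)).compAlternatingMap b.det := by
    refine b.ext_alternating fun σ hσ => ?_
    obtain ⟨τ, rfl⟩ : ∃ τ : Equiv.Perm (Fin n), ⇑τ = σ :=
      ⟨Equiv.ofBijective σ (Finite.injective_iff_bijective.1 hσ), rfl⟩
    change g (⇑b ∘ ⇑τ) = LinearMap.toSpanSingleton K N (f v) (b.det (⇑b ∘ ⇑τ))
    rw [AlternatingMap.map_perm, AlternatingMap.map_perm, hg, b.det_self]
    simp [Units.smul_def, Int.cast_smul_eq_zsmul]
  have h : g A = b.det A • f v := congr($key A)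
  have hd : b.det A = A.det := by rw [Pi.basisFun_det]; rfl
  rw [← hd, ← h]
  rfl

variable {L : Type} [Field L] [Algebra ℂ L] {t : Fin 3 → L}

/-- In characteristic zero a transcendence basis has independent differentials, for the
extension it generates is purely transcendental and the rest is separable algebraic, hence formally
étale. -/
lemma exists_basis_D (ht : IsTranscendenceBasis ℂ t) :
    ∃ b : Module.Basis (Fin 3) L (Ω[L⁄ℂ]), ∀ i, b i = KaehlerDifferential.D ℂ L (t i) := by
  let P := MvPolynomial (Fin 3) ℂ
  let Q := FractionRing P
  let _ : Algebra P L := (MvPolynomial.aeval t).toAlgebra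
  have : IsScalarTower ℂ P L := .of_algebraMap_eq' (MvPolynomial.aeval t).comp_algebraMap.symm
  have hinj : Function.Injective (algebraMap P L) := ht.1
  have : FaithfulSMul P L := (faithfulSMul_iff_algebraMap_injective P L).2 hinj
  let _ : Algebra Q L := FractionRing.liftAlgebra P L
  have : Algebra.IsAlgebraic P L := by
    have := ht.isAlgebraic
    refine Algebra.IsAlgebraic.of_ringHom_of_comp_eq ht.1.aevalEquiv (RingHom.id L)
      ht.1.aevalEquiv.surjective Function.injective_id ?_
    ext <;> simp [RingHom.algebraMap_toAlgebra]
  have : Algebra.IsAlgebraic Q L :=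
    Algebra.IsAlgebraic.extendScalars (R := P) (IsFractionRing.injective P Q)
  have : Algebra.FormallyEtale P Q := .of_isLocalization (nonZeroDivisors P)
  have : Algebra.FormallyEtale Q L := .of_isSeparable Q L
  have : Algebra.FormallyEtale P L := .comp P Q L
  refine ⟨((KaehlerDifferential.mvPolynomialBasis ℂ (Fin 3)).baseChange L).map
    (KaehlerDifferential.tensorKaehlerEquivOfFormallyEtale ℂ P L), fun i => ?_⟩
  have : algebraMap P L (MvPolynomial.X i) = t i := MvPolynomial.aeval_X t i
  simp only [Module.Basis.map_apply, Module.Basis.baseChange_apply,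
    KaehlerDifferential.mvPolynomialBasis_apply]
  refine (KaehlerDifferential.mapBaseChange_tmul ℂ P L _ _).trans ?_
  rw [one_smul, KaehlerDifferential.map_D, this]

lemma volumeForm_ne_zero (ht : IsTranscendenceBasis ℂ t) : volumeForm t ≠ 0 := by
  obtain ⟨b, hb⟩ := exists_basis_D ht
  intro h
  have := congrArg (exteriorPower.alternatingMapLinearEquiv b.det) h
  rw [volumeForm, exteriorPower.alternatingMapLinearEquiv_apply_ιMulti, ← funext hb, map_zero,
    b.det_self] at this
  exact one_ne_zero this

/-- The converse of `volumeForm_ne_zero`: if the `dxᵢ` are independent, they span, so `L` has no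
differentials over `ℂ(x₀, x₁, x₂)` and is separable algebraic over it. -/
lemma isTranscendenceBasis_of_volumeForm_ne_zero [Algebra.EssFiniteType ℂ L]
    (ht : IsTranscendenceBasis ℂ t) {x : Fin 3 → L} (hx : volumeForm x ≠ 0) :
    IsTranscendenceBasis ℂ x := by
  obtain ⟨b, hb⟩ := exists_basis_D ht
  have hli : LinearIndependent L (fun i => KaehlerDifferential.D ℂ L (x i)) := by
    by_contra h
    exact hx (AlternatingMap.map_linearDependent _ _ h)
  have hspan := hli.span_eq_top_of_card_eq_finrank (by
    rw [Module.finrank_eq_card_basis b])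
  let F := IntermediateField.adjoin ℂ (Set.range x)
  have hsub : Subsingleton (Ω[L⁄F]) := by
    have h0 : KaehlerDifferential.map ℂ F L L = 0 := by
      rw [← LinearMap.ker_eq_top, ← top_le_iff, ← hspan, Submodule.span_le]
      rintro _ ⟨i, rfl⟩
      have : x i ∈ F := IntermediateField.subset_adjoin _ _ ⟨i, rfl⟩
      change KaehlerDifferential.map ℂ F L L (KaehlerDifferential.D ℂ L (x i)) = 0
      rw [KaehlerDifferential.map_D]
      exact (KaehlerDifferential.D F L).map_algebraMap (⟨x i, this⟩ : F)
    refine subsingleton_of_forall_eq 0 fun z => ?_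
    obtain ⟨y, rfl⟩ := KaehlerDifferential.map_surjective ℂ F L z
    rw [h0]; rfl
  have : Algebra.FormallyUnramified F L := ⟨hsub⟩
  have : Algebra.EssFiniteType F L := .of_comp ℂ F L
  have : Algebra.IsSeparable F L := (Algebra.FormallyUnramified.iff_isSeparable F L).1 inferInstance
  have : Algebra.IsAlgebraic (Algebra.adjoin ℂ (Set.range x)) L := .trans _ F _
  exact Algebra.IsAlgebraic.isTranscendenceBasis_of_le_trdeg_of_finite ℂ x ht.cardinalMk_eq_trdeg.le

end VolumeForm

/-! ### Points of the double covering with independent coordinates -/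

section Injectivity

/-- The plane `x = 0` is the first of the arrangement and occurs only once. -/
def FirstPlaneSimple (D : Arrangement) : Prop :=
  D 0 = ![1, 0, 0, 0] ∧ ∀ i, i ≠ 0 → ∃ j, j ≠ 0 ∧ D i j ≠ 0

lemma not_X_dvd_affineForm {a : Fin 4 → ℂ} (ha : ∃ j, j ≠ 0 ∧ a j ≠ 0) :
    ¬ (MvPolynomial.X 0 : MvPolynomial (Fin 3) ℂ) ∣ affineForm a := by
  rintro ⟨q, hq⟩
  have h (y z : ℂ) : a 1 * y + a 2 * z + a 3 = 0 := by
    simpa [affineForm] using congrArg (MvPolynomial.eval ![0, y, z]) hq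
  have h3 := h 0 0
  have h2 := h 0 1
  have h1 := h 1 0
  obtain ⟨j, hj, hj'⟩ := ha
  apply hj'
  fin_cases j
  · exact absurd rfl hj
  · simpa using by linear_combination h1 - h3
  · simpa using by linear_combination h2 - h3
  · simpa using h3

/-- The branch polynomial is not a square in `ℂ(x, y, z)`, since it vanishes simply on `x = 0`. -/
lemma eq_zero_of_sq_eq_sq_mul_branchPolynomial {D : Arrangement} (hD : FirstPlaneSimple D)
    {a b : MvPolynomial (Fin 3) ℂ} (h : a ^ 2 = b ^ 2 * branchPolynomial D) : b = 0 := by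
  have hp := MvPolynomial.X_prime (σ := Fin 3) (R := ℂ) (i := 0)
  by_contra hb
  obtain ⟨g, hg, hg'⟩ : ∃ g, branchPolynomial D = MvPolynomial.X 0 * g ∧
      ¬ (MvPolynomial.X 0 : MvPolynomial (Fin 3) ℂ) ∣ g := by
    refine ⟨∏ i : Fin 7, affineForm (D i.succ), ?_, ?_⟩
    · rw [branchPolynomial, Fin.prod_univ_succ, hD.1]
      simp [affineForm]
    · rw [hp.dvd_finsetProd_iff]
      rintro ⟨i, -, hi⟩
      exact not_X_dvd_affineForm (hD.2 _ (Fin.succ_ne_zero i)) hi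
  have hg0 : g ≠ 0 := by rintro rfl; simp at hg'
  have ha : a ≠ 0 := by
    rintro rfl
    apply hb
    have : b ^ 2 * (MvPolynomial.X 0 * g) = 0 := by rw [← hg, ← h]; ring
    simpa [hg0, hp.ne_zero] using this
  have e := congrArg (emultiplicity (MvPolynomial.X 0 : MvPolynomial (Fin 3) ℂ)) h
  have hfa : FiniteMultiplicity (MvPolynomial.X 0 : MvPolynomial (Fin 3) ℂ) a :=
    .of_prime_left hp ha
  have hfb : FiniteMultiplicity (MvPolynomial.X 0 : MvPolynomial (Fin 3) ℂ) b :=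
    .of_prime_left hp hb
  rw [hg, emultiplicity_mul hp, emultiplicity_mul hp, emultiplicity_pow hp, emultiplicity_pow hp,
    emultiplicity_eq_zero.2 hg',
    (FiniteMultiplicity.of_prime_left hp hp.ne_zero).emultiplicity_self,
    hfa.emultiplicity_eq_multiplicity, hfb.emultiplicity_eq_multiplicity] at e
  norm_cast at e
  omega

/-- A point of the double covering with algebraically independent coordinates is generic: an element
`a + b u` that vanishes there has `a² = b² f`, and `f` is not a square. -/
lemma injective_of_algebraicIndependent {L : Type} [Field L] [Algebra ℂ L] {D : Arrangement}
    (hD : FirstPlaneSimple D) (φ : CoverRing D →ₐ[ℂ] L)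
    (h : AlgebraicIndependent ℂ (fun i => φ (coord D i))) : Function.Injective φ := by
  rw [injective_iff_map_eq_zero]
  intro z hz
  let f : Polynomial (MvPolynomial (Fin 3) ℂ) :=
    Polynomial.X ^ 2 - Polynomial.C (branchPolynomial D)
  have hf : f.Monic := Polynomial.monic_X_pow_sub_C _ two_ne_zero
  obtain ⟨p, rfl⟩ := AdjoinRoot.mk_surjective z
  obtain ⟨a, b, hab⟩ : ∃ a b : MvPolynomial (Fin 3) ℂ,
      AdjoinRoot.mk f p = AdjoinRoot.of f a + AdjoinRoot.of f b * AdjoinRoot.root f := by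
    have hd : (p %ₘ f).natDegree ≤ 1 := by
      have := Polynomial.natDegree_modByMonic_lt p hf fun e => by
        simpa [f, Polynomial.natDegree_X_pow_sub_C] using congrArg Polynomial.natDegree e
      rw [Polynomial.natDegree_X_pow_sub_C] at this
      omega
    obtain ⟨b, a, h'⟩ := Polynomial.exists_eq_X_add_C_of_natDegree_le_one hd
    refine ⟨a, b, ?_⟩
    rw [← AdjoinRoot.mk_leftInverse hf (AdjoinRoot.mk f p), AdjoinRoot.modByMonicHom_mk, h']
    simp [add_comm]
  have hof (q : MvPolynomial (Fin 3) ℂ) :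
      φ (AdjoinRoot.of f q) = MvPolynomial.aeval (fun i => φ (coord D i)) q := by
    refine DFunLike.congr_fun (f := φ.comp (IsScalarTower.toAlgHom ℂ _ (CoverRing D))) ?_ q
    ext i
    simp [coord]
  have hroot : φ (AdjoinRoot.root f) ^ 2 = φ (AdjoinRoot.of f (branchPolynomial D)) := by
    rw [← map_pow]
    congr 1
    have := AdjoinRoot.eval₂_root f
    simpa [f, sub_eq_zero] using this
  have hz' : φ (AdjoinRoot.mk f p) = 0 := hz
  rw [hab, map_add, map_mul, hof, hof] at hz'
  rw [hof] at hroot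
  have hsq : a ^ 2 = b ^ 2 * branchPolynomial D := h <| by
    rw [map_pow, map_mul, map_pow, ← hroot]
    linear_combination (MvPolynomial.aeval (fun i => φ (coord D i)) a -
      MvPolynomial.aeval (fun i => φ (coord D i)) b * φ (AdjoinRoot.root f)) * hz'
  have hb := eq_zero_of_sq_eq_sq_mul_branchPolynomial hD hsq
  have ha : a = 0 := by simpa [hb] using hsq
  rw [hab, ha, hb]
  simp

end Injectivity

section SquareRoots

/-- A finitely generated extension of `ℂ(t₀, t₁, t₂)` containing square roots of two given
polynomials. -/
lemma exists_field_of_sq (P Q : MvPolynomial (Fin 3) ℂ) :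
    ∃ (L : Type) (_ : Field L) (_ : Algebra ℂ L) (t : Fin 3 → L) (v w : L),
      Algebra.EssFiniteType ℂ L ∧ IsTranscendenceBasis ℂ t ∧
      v ^ 2 = MvPolynomial.aeval t P ∧ w ^ 2 = MvPolynomial.aeval t Q := by
  let Ω' := AlgebraicClosure (FractionRing (MvPolynomial (Fin 3) ℂ))
  let s : Fin 3 → Ω' := fun i => algebraMap (MvPolynomial (Fin 3) ℂ) Ω' (MvPolynomial.X i)
  have hs : IsTranscendenceBasis ℂ s := by
    have hi : AlgebraicIndependent ℂ s :=
      (MvPolynomial.algebraicIndependent_X (Fin 3) ℂ).map'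
        (f := IsScalarTower.toAlgHom ℂ (MvPolynomial (Fin 3) ℂ) Ω')
        (by
          change Function.Injective (algebraMap (MvPolynomial (Fin 3) ℂ) Ω')
          rw [IsScalarTower.algebraMap_eq _ (FractionRing (MvPolynomial (Fin 3) ℂ)) Ω']
          exact (FaithfulSMul.algebraMap_injective (FractionRing (MvPolynomial (Fin 3) ℂ)) Ω').comp
            (IsFractionRing.injective _ _))
    rw [hi.isTranscendenceBasis_iff_isAlgebraic]
    have : Algebra.IsAlgebraic (MvPolynomial (Fin 3) ℂ) (FractionRing (MvPolynomial (Fin 3) ℂ)) :=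
      IsLocalization.isAlgebraic _ (nonZeroDivisors _)
    have : Algebra.IsAlgebraic (MvPolynomial (Fin 3) ℂ) Ω' :=
      .trans _ (FractionRing (MvPolynomial (Fin 3) ℂ)) _
    refine Algebra.IsAlgebraic.ringHom_of_comp_eq hi.aevalEquiv (RingHom.id Ω')
      hi.aevalEquiv.injective Function.surjective_id ?_
    ext x
    · simpa using IsScalarTower.algebraMap_apply ℂ (MvPolynomial (Fin 3) ℂ) Ω' x
    · simp [s]
  obtain ⟨v, hv⟩ := IsAlgClosed.exists_pow_nat_eq (MvPolynomial.aeval s P) zero_lt_two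
  obtain ⟨w, hw⟩ := IsAlgClosed.exists_pow_nat_eq (MvPolynomial.aeval s Q) zero_lt_two
  let T : Set Ω' := Set.range s ∪ {v, w}
  let L := IntermediateField.adjoin ℂ T
  have hsT : ∀ i, s i ∈ L := fun i => IntermediateField.subset_adjoin _ _ (.inl ⟨i, rfl⟩)
  have hvT : v ∈ L := IntermediateField.subset_adjoin _ _ (.inr (by simp))
  have hwT : w ∈ L := IntermediateField.subset_adjoin _ _ (.inr (by simp))
  have hcomp : ∀ R : MvPolynomial (Fin 3) ℂ,
      ((MvPolynomial.aeval (fun i => (⟨s i, hsT i⟩ : L)) R : L) : Ω') = MvPolynomial.aeval s R := by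
    intro R
    exact (MvPolynomial.aeval_algebraMap_apply Ω' (fun i => (⟨s i, hsT i⟩ : L)) R).symm
  refine ⟨L, inferInstance, inferInstance, fun i => ⟨s i, hsT i⟩, ⟨v, hvT⟩, ⟨w, hwT⟩,
    ?_, ?_, ?_, ?_⟩
  · exact IntermediateField.essFiniteType_iff.2
      (IntermediateField.fg_adjoin_of_finite (Set.toFinite T))
  · have hi : AlgebraicIndependent ℂ (fun i => (⟨s i, hsT i⟩ : L)) :=
      AlgebraicIndependent.of_comp L.val hs.1
    refine hi.isTranscendenceBasis_of_trdeg_le_of_finite ?_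
    rw [hs.cardinalMk_eq_trdeg]
    exact trdeg_le_of_injective L.val L.val.injective
  · apply Subtype.ext; rw [hcomp, ← hv]; rfl
  · apply Subtype.ext; rw [hcomp, ← hw]; rfl

end SquareRoots

/-! ### Pull-backs of the three-form along points in homogeneous coordinates -/

section Pullback

lemma det_fin_four {K : Type*} [CommRing K] (M : Matrix (Fin 4) (Fin 4) K) :
    M.det = M 0 3 * -(M 1 0 * (M 2 1 * M 3 2 - M 2 2 * M 3 1)
        - M 1 1 * (M 2 0 * M 3 2 - M 2 2 * M 3 0)
        + M 1 2 * (M 2 0 * M 3 1 - M 2 1 * M 3 0)) +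
      M 1 3 * (M 0 0 * (M 2 1 * M 3 2 - M 2 2 * M 3 1) - M 0 1 * (M 2 0 * M 3 2 - M 2 2 * M 3 0)
        + M 0 2 * (M 2 0 * M 3 1 - M 2 1 * M 3 0)) -
      M 2 3 * (M 0 0 * (M 1 1 * M 3 2 - M 1 2 * M 3 1) - M 0 1 * (M 1 0 * M 3 2 - M 1 2 * M 3 0)
        + M 0 2 * (M 1 0 * M 3 1 - M 1 1 * M 3 0)) +
      M 3 3 * (M 0 0 * (M 1 1 * M 2 2 - M 1 2 * M 2 1) - M 0 1 * (M 1 0 * M 2 2 - M 1 2 * M 2 0)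
        + M 0 2 * (M 1 0 * M 2 1 - M 1 1 * M 2 0)) := by
  simp [Matrix.det_succ_row_zero, Fin.sum_univ_succ, Fin.succAbove]
  ring

/-- The Jacobian of the passage from affine to homogeneous coordinates, after a linear change of
coordinates. -/
lemma det_dehomogenize {K : Type*} [Field K] (M : Matrix (Fin 4) (Fin 4) K) (y : Fin 3 → K)
    (X : Fin 4 → K) (hX : ∀ i, X i = M i 0 * y 0 + M i 1 * y 1 + M i 2 * y 2 + M i 3)
    (h : X 3 ≠ 0) :
    (Matrix.of fun i j : Fin 3 => (X 3)⁻¹ *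
      (M i.castSucc j.castSucc - X i.castSucc / X 3 * M 3 j.castSucc)).det * X 3 ^ 4 = M.det := by
  have e (i : Fin 4) := eq_sub_of_add_eq' (hX i).symm
  have h0 : Fin.castSucc (0 : Fin 3) = 0 := rfl
  have h1 : Fin.castSucc (1 : Fin 3) = 1 := rfl
  have h2 : Fin.castSucc (2 : Fin 3) = 2 := rfl
  rw [det_fin_four, Matrix.det_fin_three]
  simp only [Matrix.of_apply, e, h0, h1, h2]
  field_simp
  ring

variable {L : Type} [Field L] [Algebra ℂ L]

/-- The form `f · dt₀ ∧ dt₁ ∧ dt₂` is the pull-back of the three-form of the double octic of `D`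
along an `L`-valued point. -/
def IsPullback (D : Arrangement) (t : Fin 3 → L) (f : L) : Prop :=
  ∃ φ : CoverRing D →ₐ[ℂ] L, threeForm D L φ.toRingHom = f • volumeForm t

lemma ne_zero_of_aeval_eq {t : Fin 3 → L} (ht : AlgebraicIndependent ℂ t)
    (p : MvPolynomial (Fin 3) ℂ) (x : Fin 3 → ℂ) {a : L} (ha : MvPolynomial.aeval t p = a)
    (hp : MvPolynomial.eval x p ≠ 0) : a ≠ 0 := by
  rintro rfl
  rw [(map_eq_zero_iff _ ht).1 ha, map_zero] at hp
  exact hp rfl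

/-- To give a correspondence it suffices to write down points of the two double coverings over the
extension of `ℂ(l, r, s)` by square roots of `P` and `Q`, with pull-backs of the three-forms that
are constant multiples of `f · dl ∧ dr ∧ ds`, for a common `f`. The points `x` and `y` only serve
to show that `P` and `Q` are not zero. -/
theorem correspond_of_isPullback {D E : Arrangement} (hD : FirstPlaneSimple D)
    (hE : FirstPlaneSimple E) (P Q : MvPolynomial (Fin 3) ℂ) {x y : Fin 3 → ℂ}
    (hP : MvPolynomial.eval x P ≠ 0) (hQ : MvPolynomial.eval y Q ≠ 0)
    (H : ∀ (L : Type) [Field L] [Algebra ℂ L] [CharZero L] (l r s v w : L),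
      AlgebraicIndependent ℂ ![l, r, s] → v ^ 2 = MvPolynomial.aeval ![l, r, s] P →
      w ^ 2 = MvPolynomial.aeval ![l, r, s] Q → v ≠ 0 → w ≠ 0 →
      ∃ (f : L) (a b : ℂ), f ≠ 0 ∧ a ≠ 0 ∧ b ≠ 0 ∧
        IsPullback D ![l, r, s] (algebraMap ℂ L a * f) ∧
        IsPullback E ![l, r, s] (algebraMap ℂ L b * f)) :
    Correspond D E := by
  obtain ⟨L, _, _, t, v, w, _, ht, hv, hw⟩ := exists_field_of_sq P Q
  have : CharZero L := charZero_of_injective_algebraMap (algebraMap ℂ L).injective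
  obtain ⟨l, r, s, rfl⟩ : ∃ l r s, t = ![l, r, s] :=
    ⟨t 0, t 1, t 2, by funext i; fin_cases i <;> rfl⟩
  obtain ⟨f, a, b, hf, ha, hb, ⟨φ, hφ⟩, ⟨ψ, hψ⟩⟩ := H L l r s v w ht.1 hv hw
    (pow_ne_zero_iff two_ne_zero |>.1 (ne_zero_of_aeval_eq ht.1 P x hv.symm hP))
    (pow_ne_zero_iff two_ne_zero |>.1 (ne_zero_of_aeval_eq ht.1 Q y hw.symm hQ))
  have ha' : algebraMap ℂ L a ≠ 0 := by simpa using ha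
  have hb' : algebraMap ℂ L b ≠ 0 := by simpa using hb
  have inj {G : Arrangement} (hG : FirstPlaneSimple G) (χ : CoverRing G →ₐ[ℂ] L) {k : L}
      (hk : k ≠ 0) (h : threeForm G L χ.toRingHom = k • volumeForm ![l, r, s]) :
      Function.Injective χ := by
    refine injective_of_algebraicIndependent hG χ
      (isTranscendenceBasis_of_volumeForm_ne_zero ht fun h0 => ?_).1
    have : threeForm G L χ.toRingHom = 0 := by
      change (χ.toRingHom (coverRoot G))⁻¹ • volumeForm (fun i => χ (coord G i)) = 0
      rw [h0, smul_zero]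
    rw [this, eq_comm, smul_eq_zero] at h
    exact h.elim hk (volumeForm_ne_zero ht)
  refine correspond_of_field (by rw [← ht.cardinalMk_eq_trdeg]; simp) φ ψ
    (inj hD φ (mul_ne_zero ha' hf) hφ) (inj hE ψ (mul_ne_zero hb' hf) hψ)
    (c := a / b) (div_ne_zero ha hb) ?_
  rw [hφ, hψ, smul_smul, map_div₀]
  congr 1
  field_simp

/-- A point of the double covering in homogeneous coordinates: if `X` depends on affine coordinates
`y` through the matrix `M`, the form `dx ∧ dy ∧ dz / u` is `det M · dy₀ ∧ dy₁ ∧ dy₂ / U`. -/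
theorem isPullback_of_homogeneous {D : Arrangement} {t y : Fin 3 → L} {k g : L}
    (hy : volumeForm y = k • volumeForm t) (M : Matrix (Fin 4) (Fin 4) ℂ) (X : Fin 4 → L)
    (hX : ∀ i, X i = algebraMap ℂ L (M i 0) * y 0 + algebraMap ℂ L (M i 1) * y 1 +
      algebraMap ℂ L (M i 2) * y 2 + algebraMap ℂ L (M i 3)) (hX3 : X 3 ≠ 0) (U : L)
    (hU : U ^ 2 = ∏ i, (algebraMap ℂ L (D i 0) * X 0 + algebraMap ℂ L (D i 1) * X 1 +
      algebraMap ℂ L (D i 2) * X 2 + algebraMap ℂ L (D i 3) * X 3)) (hU0 : U ≠ 0)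
    (hg : algebraMap ℂ L M.det * k = g * U) : IsPullback D t g := by
  let x : Fin 3 → L := fun i => X i.castSucc / X 3
  let u : L := U / X 3 ^ 4
  have hu : u ^ 2 = MvPolynomial.aeval x (branchPolynomial D) := by
    simp only [u, div_pow, hU, branchPolynomial, map_prod]
    rw [← pow_mul, show 4 * 2 = Fintype.card (Fin 8) from rfl, ← Finset.card_univ,
      ← Finset.prod_const, ← Finset.prod_div_distrib]
    refine Finset.prod_congr rfl fun i _ => ?_
    simp only [affineForm, map_add, map_mul, MvPolynomial.aeval_X, MvPolynomial.aeval_C, x]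
    have h0 : Fin.castSucc (0 : Fin 3) = 0 := rfl
    have h1 : Fin.castSucc (1 : Fin 3) = 1 := rfl
    have h2 : Fin.castSucc (2 : Fin 3) = 2 := rfl
    rw [h0, h1, h2]
    field_simp
  let φ : CoverRing D →ₐ[ℂ] L := AdjoinRoot.liftAlgHom _ (MvPolynomial.aeval x) u (by
    simp [hu])
  refine ⟨φ, ?_⟩
  have hφx (i : Fin 3) : φ (coord D i) = x i := by
    simp [φ, coord, AdjoinRoot.liftAlgHom]
  have hφu : φ (coverRoot D) = u := by
    simp [φ, coverRoot, AdjoinRoot.liftAlgHom]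
  have h3 : threeForm D L φ.toRingHom = u⁻¹ • volumeForm x := by
    change (φ (coverRoot D))⁻¹ • volumeForm (fun i => φ (coord D i)) = _
    rw [hφu, funext hφx]
  let d := KaehlerDifferential.D ℂ L
  let A : Matrix (Fin 3) (Fin 3) L := Matrix.of fun i j => (X 3)⁻¹ *
    (algebraMap ℂ L (M i.castSucc j.castSucc) - x i * algebraMap ℂ L (M 3 j.castSucc))
  have hdX (i : Fin 4) : d (X i) = algebraMap ℂ L (M i 0) • d (y 0) +
      algebraMap ℂ L (M i 1) • d (y 1) + algebraMap ℂ L (M i 2) • d (y 2) := by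
    simp [hX i, d, Derivation.leibniz]
  have hdx (i : Fin 3) : d (x i) = ∑ j, A i j • d (y j) := by
    have : d (x i) = (X 3)⁻¹ • (d (X i.castSucc) - x i • d (X 3)) := by
      simp only [x, d, Derivation.leibniz_div]
      match_scalars <;> field_simp
    rw [this, hdX, hdX, Fin.sum_univ_three]
    simp only [A, Matrix.of_apply]
    have h0 : Fin.castSucc (0 : Fin 3) = 0 := rfl
    have h1 : Fin.castSucc (1 : Fin 3) = 1 := rfl
    have h2 : Fin.castSucc (2 : Fin 3) = 2 := rfl
    rw [h0, h1, h2]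
    module
  have hvol : volumeForm x = A.det • volumeForm y := by
    rw [volumeForm, volumeForm, ← alternatingMap_sum_smul]
    exact congrArg _ (funext hdx)
  have hdet : A.det * X 3 ^ 4 = algebraMap ℂ L M.det := by
    rw [RingHom.map_det]
    exact det_dehomogenize (M.map (algebraMap ℂ L)) y X hX hX3
  rw [h3, hvol, hy, smul_smul, smul_smul, eq_div_of_mul_eq hU0 hg.symm, ← hdet]
  congr 1
  simp only [u]
  field_simp

end Pullback

/-! ### Derivatives along the fibres -/

section RelativeDerivative

variable {L : Type} [Field L] [Algebra ℂ L] {l r a b p q : L}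

/-- `da = q dr` modulo `dl`: the function `a` has derivative `q` with respect to `r` along the
fibres of `l`. For `l = 0` this means `da = q dr`. -/
def HasRelDeriv (l r a q : L) : Prop :=
  ∃ e : L, KaehlerDifferential.D ℂ L a =
    q • KaehlerDifferential.D ℂ L r + e • KaehlerDifferential.D ℂ L l

namespace HasRelDeriv

lemma fibre : HasRelDeriv l r r 1 := ⟨0, by simp⟩

lemma base : HasRelDeriv l r l 0 := ⟨1, by simp⟩

lemma const (c : ℂ) : HasRelDeriv l r (algebraMap ℂ L c) 0 := ⟨0, by simp⟩

lemma one : HasRelDeriv l r (1 : L) 0 := ⟨0, by simp⟩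

lemma ofNat (n : ℕ) [n.AtLeastTwo] : HasRelDeriv l r (OfNat.ofNat n : L) 0 := by
  simpa only [map_ofNat] using const (l := l) (r := r) (OfNat.ofNat n)

lemma congr (h : HasRelDeriv l r a p) (e : p = q) : HasRelDeriv l r a q := e ▸ h

lemma add (ha : HasRelDeriv l r a p) (hb : HasRelDeriv l r b q) :
    HasRelDeriv l r (a + b) (p + q) := by
  obtain ⟨e, he⟩ := ha
  obtain ⟨e', he'⟩ := hb
  exact ⟨e + e', by rw [map_add, he, he']; module⟩

lemma neg (ha : HasRelDeriv l r a p) : HasRelDeriv l r (-a) (-p) := by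
  obtain ⟨e, he⟩ := ha
  exact ⟨-e, by rw [map_neg, he]; module⟩

lemma sub (ha : HasRelDeriv l r a p) (hb : HasRelDeriv l r b q) :
    HasRelDeriv l r (a - b) (p - q) := by
  simpa [sub_eq_add_neg] using ha.add hb.neg

lemma mul (ha : HasRelDeriv l r a p) (hb : HasRelDeriv l r b q) :
    HasRelDeriv l r (a * b) (a * q + b * p) := by
  obtain ⟨e, he⟩ := ha
  obtain ⟨e', he'⟩ := hb
  exact ⟨a * e' + b * e, by rw [Derivation.leibniz, he, he']; module⟩

lemma div (ha : HasRelDeriv l r a p) (hb : HasRelDeriv l r b q) :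
    HasRelDeriv l r (a / b) ((b * p - a * q) / b ^ 2) := by
  obtain ⟨e, he⟩ := ha
  obtain ⟨e', he'⟩ := hb
  exact ⟨(b * e - a * e') / b ^ 2, by
    rw [Derivation.leibniz_div, he, he']; match_scalars <;> field_simp⟩

lemma sq (ha : HasRelDeriv l r a p) : HasRelDeriv l r (a ^ 2) (2 * a * p) := by
  rw [pow_two]; exact (ha.mul ha).congr (by ring)

lemma of_sq [CharZero L] (h : HasRelDeriv l r (a ^ 2) q) (ha : a ≠ 0) :
    HasRelDeriv l r a (q / (2 * a)) := by
  obtain ⟨e, he⟩ := h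
  refine ⟨e / (2 * a), ?_⟩
  rw [pow_two, Derivation.leibniz] at he
  have h2 : (2 * a) • KaehlerDifferential.D ℂ L a = q • KaehlerDifferential.D ℂ L r +
    e • KaehlerDifferential.D ℂ L l := by rw [← he]; module
  have := congrArg ((2 * a)⁻¹ • ·) h2
  simp only [smul_smul, smul_add] at this
  rw [inv_mul_cancel₀ (mul_ne_zero two_ne_zero ha), one_smul] at this
  rw [this]
  match_scalars <;> field_simp

end HasRelDeriv

/-- The Jacobian of a map that respects the projection to the first coordinate and is fibrewise a
product. -/
lemma volumeForm_of_hasRelDeriv {l r s l' a b p q m : L} (hl : HasRelDeriv 0 l l' p)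
    (ha : HasRelDeriv l r a q) (hb : HasRelDeriv l s b m) :
    volumeForm ![l', a, b] = (p * q * m) • volumeForm ![l, r, s] := by
  obtain ⟨e0, h0⟩ := hl
  obtain ⟨e1, h1⟩ := ha
  obtain ⟨e2, h2⟩ := hb
  have hdet : (!![p, 0, 0; e1, q, 0; e2, 0, m] : Matrix (Fin 3) (Fin 3) L).det = p * q * m := by
    simp [Matrix.det_fin_three]
  rw [volumeForm, volumeForm, ← hdet, ← alternatingMap_sum_smul]
  congr 1
  funext i
  fin_cases i
  · simp [Fin.sum_univ_three, h0]
  · simp [Fin.sum_univ_three, h1, add_comm]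
  · simp [Fin.sum_univ_three, h2, add_comm]

end RelativeDerivative

/-! ### The isogeny of degree two -/

section Points

variable {L : Type} [Field L] [Algebra ℂ L]

lemma algebraMap_I_sq : algebraMap ℂ L Complex.I ^ 2 = -1 := by
  rw [← map_pow, Complex.I_sq, map_neg, map_one]

/-- The two-isogeny `v² = (r² - 1)(r² - m²) → z² = (s² - (m + 1)²)(s² - (m - 1)²)`,
`s = i v / r`, `z = r² - m² / r²`, respects the relative differentials: `ds / z = i dr / v`. -/
lemma exists_landen [CharZero L] {l r m v : L} (hm : HasRelDeriv l r m 0) (hr : r ≠ 0)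
    (hrm : r ^ 4 - m ^ 2 ≠ 0) (hv0 : v ≠ 0) (hv : v ^ 2 = (r ^ 2 - 1) * (r ^ 2 - m ^ 2)) :
    ∃ s z : L, z ≠ 0 ∧ z ^ 2 = (s ^ 2 - (m + 1) ^ 2) * (s ^ 2 - (m - 1) ^ 2) ∧
      HasRelDeriv l r s (algebraMap ℂ L Complex.I * z / v) := by
  have hI := algebraMap_I_sq (L := L)
  set i := algebraMap ℂ L Complex.I
  have hi0 : i ≠ 0 := by rintro h; simp [h] at hI
  have hs : (i * v / r) ^ 2 = -((r ^ 2 - 1) * (r ^ 2 - m ^ 2) / r ^ 2) := by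
    rw [div_pow, mul_pow, hI, hv]; ring
  refine ⟨i * v / r, r ^ 2 - m ^ 2 / r ^ 2, ?_, ?_, ?_⟩
  · convert div_ne_zero hrm (pow_ne_zero 2 hr) using 1
    field_simp
  · rw [hs]; field_simp; ring
  · have h := ((((HasRelDeriv.fibre (l := l) (r := r)).sq.sub .one).mul
      (HasRelDeriv.fibre.sq.sub hm.sq)).div HasRelDeriv.fibre.sq).neg
    rw [← hs] at h
    refine (h.of_sq (by simp [*])).congr ?_
    field_simp
    linear_combination (-2 * r ^ 4 + 2 * m ^ 2) * hI

lemma volumeForm_eq_one_smul (t : Fin 3 → L) : volumeForm t = (1 : L) • volumeForm t :=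
  (one_smul _ _).symm

end Points

/-! ### Rigid arrangements -/

section Rigid

open MvPolynomial

lemma firstPlaneSimple_arr1 : FirstPlaneSimple arr1 :=
  ⟨rfl, by simp [Fin.forall_fin_succ, Fin.exists_fin_succ, arr1]⟩

lemma firstPlaneSimple_arr32 : FirstPlaneSimple arr32 :=
  ⟨rfl, by simp [Fin.forall_fin_succ, Fin.exists_fin_succ, arr32]⟩

lemma firstPlaneSimple_arr93 : FirstPlaneSimple arr93 :=
  ⟨rfl, by simp [Fin.forall_fin_succ, Fin.exists_fin_succ, arr93]⟩

lemma firstPlaneSimple_arr238 : FirstPlaneSimple arr238 :=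
  ⟨rfl, by simp [Fin.forall_fin_succ, Fin.exists_fin_succ, arr238]⟩

lemma firstPlaneSimple_arr240 : FirstPlaneSimple arr240 :=
  ⟨rfl, by simp [Fin.forall_fin_succ, Fin.exists_fin_succ, arr240]⟩

lemma firstPlaneSimple_arr241 : FirstPlaneSimple arr241 :=
  ⟨rfl, by simp [Fin.forall_fin_succ, Fin.exists_fin_succ, arr241]⟩

lemma firstPlaneSimple_arr245 : FirstPlaneSimple arr245 :=
  ⟨rfl, by simp [Fin.forall_fin_succ, Fin.exists_fin_succ, arr245]⟩

/-- The fibre square over the `l`-line of the family of elliptic curves `v² = (r² - 1)(r² - l²)`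
maps to the double octic of no. 238, and to the one of no. 1 by squaring `l`, `r` and `s`. -/
theorem correspond_arr1_arr238 : Correspond arr1 arr238 := by
  refine correspond_of_isPullback firstPlaneSimple_arr1 firstPlaneSimple_arr238
    ((X 1 ^ 2 - 1) * (X 1 ^ 2 - X 0 ^ 2)) ((X 2 ^ 2 - 1) * (X 2 ^ 2 - X 0 ^ 2))
    (x := ![0, 2, 0]) (y := ![0, 0, 2]) (by norm_num) (by simp; norm_num)
    fun L _ _ _ l r s v w ht hv hw hv0 hw0 => ?_
  have hl : l ≠ 0 := ht.ne_zero 0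
  have hr : r ≠ 0 := ht.ne_zero 1
  have hs : s ≠ 0 := ht.ne_zero 2
  have hs1 : s - 1 ≠ 0 :=
    ne_zero_of_aeval_eq ht (X 2 - 1) ![0, 0, 0] (by simp) (by simp)
  simp at hv hw
  refine ⟨(v * w)⁻¹, -8, -1, by simp [*], by simp, by simp, ?_, ?_⟩
  · refine isPullback_of_homogeneous
      (volumeForm_of_hasRelDeriv (HasRelDeriv.fibre (r := l)).sq
        (HasRelDeriv.fibre (r := r)).sq (HasRelDeriv.fibre (r := s)).sq)
      !![1, 0, 0, 0; 0, -1, 0, 0; 0, 0, 0, 1; 0, 0, -1, 0]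
      ![l ^ 2, -r ^ 2, 1, -s ^ 2] ?_ ?_ (l * r * s * v * w) ?_ ?_ ?_
    · simp [Fin.forall_fin_succ]
    · simpa using hs
    · simp [Fin.prod_univ_eight, arr1, mul_pow, hv, hw]
      ring
    · simp [*]
    · rw [det_fin_four]; simp [map_ofNat]; field_simp; norm_num
  · refine isPullback_of_homogeneous (volumeForm_eq_one_smul _)
      !![1, 1, 0, 0; -1, 1, 0, 0; 0, 0, 1, 1; 0, 0, 1, -1]
      ![l + r, -l + r, s + 1, s - 1] ?_ ?_ (4 * v * w) ?_ ?_ ?_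
    · simp [Fin.forall_fin_succ, sub_eq_add_neg]
    · simpa using hs1
    · simp [Fin.prod_univ_eight, arr238, mul_pow, hv, hw]
      ring
    · simp [*]
    · rw [det_fin_four]; simp; field_simp; norm_num

/-- The double octics of no. 238 and no. 241 come from fibre products with one factor in common; the
other factors are related by the isogeny `exists_landen`. -/
theorem correspond_arr238_arr241 : Correspond arr238 arr241 := by
  refine correspond_of_isPullback firstPlaneSimple_arr238 firstPlaneSimple_arr241
    ((X 1 ^ 2 - 1) * (X 1 ^ 2 - X 0 ^ 2)) ((X 2 ^ 2 - 1) * (X 2 ^ 2 - X 0 ^ 2))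
    (x := ![0, 2, 0]) (y := ![0, 0, 2]) (by norm_num) (by simp; norm_num)
    fun L _ _ _ l r s v w ht hv hw hv0 hw0 => ?_
  have hr : r ≠ 0 := ht.ne_zero 1
  have hs1 : s - 1 ≠ 0 :=
    ne_zero_of_aeval_eq ht (X 2 - 1) ![0, 0, 0] (by simp) (by simp)
  have hrl : r ^ 4 - l ^ 2 ≠ 0 :=
    ne_zero_of_aeval_eq ht (X 1 ^ 4 - X 0 ^ 2) ![1, 0, 0] (by simp) (by simp)
  simp at hv hw
  obtain ⟨b, z, hz0, hz, hb⟩ := exists_landen HasRelDeriv.base hr hrl hv0 hv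
  have hI := algebraMap_I_sq (L := L)
  refine ⟨(v * w)⁻¹, -1, -2, by simp [*], by simp, by simp, ?_, ?_⟩
  · refine isPullback_of_homogeneous (volumeForm_eq_one_smul _)
      !![1, 1, 0, 0; -1, 1, 0, 0; 0, 0, 1, 1; 0, 0, 1, -1]
      ![l + r, -l + r, s + 1, s - 1] ?_ ?_ (4 * v * w) ?_ ?_ ?_
    · simp [Fin.forall_fin_succ, sub_eq_add_neg]
    · simpa using hs1
    · simp [Fin.prod_univ_eight, arr238, mul_pow, hv, hw]
      ring
    · simp [*]
    · rw [det_fin_four]; simp; field_simp; norm_num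
  · refine isPullback_of_homogeneous
      (volumeForm_of_hasRelDeriv (s := s) .fibre hb .fibre)
      !![1, -1, 0, -1; 1, 1, 0, 1; 0, 0, 1, 1; 0, 0, 1, -1]
      ![l - b - 1, l + b + 1, s + 1, s - 1] ?_ ?_ (2 * algebraMap ℂ L Complex.I * z * w) ?_ ?_ ?_
    · simp [Fin.forall_fin_succ, sub_eq_add_neg]
    · simpa using hs1
    · simp [Fin.prod_univ_eight, arr241, mul_pow, hI, hz, hw]
      ring
    · simp [*]
    · rw [det_fin_four]; simp [map_ofNat]; field_simp; norm_num

/-- Both double octics come from fibre products with the factor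
`w² = (l + 1) s (s - l) (s - 1)`; the other factors are related by the isogeny `exists_landen`. -/
theorem correspond_arr32_arr93 : Correspond arr32 arr93 := by
  refine correspond_of_isPullback firstPlaneSimple_arr32 firstPlaneSimple_arr93
    ((X 1 ^ 2 - 1) * (X 1 ^ 2 - X 0 ^ 2)) ((X 0 + 1) * X 2 * (X 2 - X 0) * (X 2 - 1))
    (x := ![0, 2, 0]) (y := ![0, 0, 2]) (by norm_num) (by simp; norm_num)
    fun L _ _ _ l r s v w ht hv hw hv0 hw0 => ?_
  have hr : r ≠ 0 := ht.ne_zero 1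
  have hs : s ≠ 0 := ht.ne_zero 2
  have hrl : r ^ 4 - l ^ 2 ≠ 0 :=
    ne_zero_of_aeval_eq ht (X 1 ^ 4 - X 0 ^ 2) ![1, 0, 0] (by simp) (by simp)
  simp at hv hw
  obtain ⟨b, z, hz0, hz, hb⟩ := exists_landen HasRelDeriv.base hr hrl hv0 hv
  -- The product of the forms of no. 32 at the point below is `8 v² w²`.
  obtain ⟨e, he⟩ := IsAlgClosed.exists_pow_nat_eq (8 : ℂ) zero_lt_two
  have he0 : e ≠ 0 := by rintro rfl; simp at he
  have he1 : algebraMap ℂ L e ≠ 0 := by simpa using he0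
  have he' : algebraMap ℂ L e ^ 2 = 8 := by rw [← map_pow, he, map_ofNat]
  refine ⟨(v * w)⁻¹, -4 / e, 2 * Complex.I, by simp [*], by simp [*], by simp, ?_, ?_⟩
  · refine isPullback_of_homogeneous (volumeForm_eq_one_smul _)
      !![0, 1, 0, -1; 1, 0, 0, 1; -1, 1, 0, 0; 0, 0, -2, 0]
      ![r - 1, l + 1, -l + r, -2 * s] ?_ ?_ (algebraMap ℂ L e * v * w) ?_ ?_ ?_
    · simp [Fin.forall_fin_succ, map_ofNat, sub_eq_add_neg]
    · simpa using hs
    · simp [Fin.prod_univ_eight, arr32, mul_pow, hv, hw, he']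
      ring
    · simp [*]
    · rw [det_fin_four]; simp [map_ofNat]; field_simp; norm_num
  · refine isPullback_of_homogeneous
      (volumeForm_of_hasRelDeriv (s := s) .fibre hb .fibre)
      !![1, 1, 0, 1; 1, -1, 0, 1; -1, -1, 0, 1; 0, 0, 2, 0]
      ![l + b + 1, l - b + 1, -l - b + 1, 2 * s] ?_ ?_ (4 * z * w) ?_ ?_ ?_
    · simp [Fin.forall_fin_succ, map_ofNat, sub_eq_add_neg]
    · simpa using hs
    · simp [Fin.prod_univ_eight, arr93, mul_pow, hz, hw]
      ring
    · simp [*]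
    · rw [det_fin_four]; simp [map_ofNat]; field_simp; norm_num

/-- Both double octics come from fibre products with the factor
`w² = s (s - 1) (s + l) (l + 1 - 2 s)`; the other factors are related by the isogeny
`exists_landen`. -/
theorem correspond_arr240_arr245 : Correspond arr240 arr245 := by
  refine correspond_of_isPullback firstPlaneSimple_arr240 firstPlaneSimple_arr245
    ((X 1 ^ 2 - 1) * (X 1 ^ 2 - X 0 ^ 2)) (X 2 * (X 2 - 1) * (X 2 + X 0) * (X 0 + 1 - 2 * X 2))
    (x := ![0, 2, 0]) (y := ![0, 0, 2]) (by norm_num) (by simp; norm_num)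
    fun L _ _ _ l r s v w ht hv hw hv0 hw0 => ?_
  have hr : r ≠ 0 := ht.ne_zero 1
  have hs : 2 - 2 * s ≠ 0 :=
    ne_zero_of_aeval_eq ht (2 - 2 * X 2) ![0, 0, 0] (by simp [map_ofNat]) (by simp)
  have hrl : r ^ 4 - l ^ 2 ≠ 0 :=
    ne_zero_of_aeval_eq ht (X 1 ^ 4 - X 0 ^ 2) ![1, 0, 0] (by simp) (by simp)
  simp at hv hw
  obtain ⟨b, z, hz0, hz, hb⟩ := exists_landen HasRelDeriv.base hr hrl hv0 hv
  have hI := algebraMap_I_sq (L := L)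
  refine ⟨(v * w)⁻¹, -1, 2, by simp [*], by simp, by simp, ?_, ?_⟩
  · refine isPullback_of_homogeneous (volumeForm_eq_one_smul _)
      !![1, 1, 0, 0; 1, -1, 0, 0; 0, 0, 2, 0; 0, 0, -2, 2]
      ![l + r, l - r, 2 * s, 2 - 2 * s] ?_ ?_ (8 * v * w) ?_ ?_ ?_
    · simp [Fin.forall_fin_succ, map_ofNat, sub_eq_add_neg, add_comm]
    · simpa using hs
    · simp [Fin.prod_univ_eight, arr240, mul_pow, hv, hw]
      ring
    · simp [*]
    · rw [det_fin_four]; simp [map_ofNat]; field_simp; norm_num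
  · refine isPullback_of_homogeneous
      (volumeForm_of_hasRelDeriv (s := s) .fibre hb .fibre)
      !![1, 1, 0, 1; 0, 0, 2, 0; 1, -1, 0, -1; 0, 0, -2, 2]
      ![l + b + 1, 2 * s, l - b - 1, 2 - 2 * s] ?_ ?_
      (4 * algebraMap ℂ L Complex.I * z * w) ?_ ?_ ?_
    · simp [Fin.forall_fin_succ, map_ofNat, sub_eq_add_neg, add_comm]
    · simpa using hs
    · simp [Fin.prod_univ_eight, arr245, mul_pow, hI, hz, hw]
      ring
    · simp [*]
    · rw [det_fin_four]; simp [map_ofNat]; field_simp; norm_num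
end Rigid

/-! ### Families -/

section Families
open MvPolynomial

lemma firstPlaneSimple_arr2 {A B : ℂ} (hB : B ≠ 0) : FirstPlaneSimple (arr2 A B) :=
  ⟨rfl, by simp [Fin.forall_fin_succ, Fin.exists_fin_succ, arr2, hB]⟩

lemma firstPlaneSimple_arr8 {A B : ℂ} (hB : B ≠ 0) : FirstPlaneSimple (arr8 A B) :=
  ⟨rfl, by simp [Fin.forall_fin_succ, Fin.exists_fin_succ, arr8, hB]⟩

lemma firstPlaneSimple_arr10 {A B : ℂ} (hB : B ≠ 0) : FirstPlaneSimple (arr10 A B) :=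
  ⟨rfl, by simp [Fin.forall_fin_succ, Fin.exists_fin_succ, arr10, hB]⟩

lemma firstPlaneSimple_arr242 {A B : ℂ} (hB : B ≠ 0) : FirstPlaneSimple (arr242 A B) :=
  ⟨rfl, by simp [Fin.forall_fin_succ, Fin.exists_fin_succ, arr242, hB]⟩

lemma firstPlaneSimple_arr247 {A B : ℂ} (hB : B ≠ 0) : FirstPlaneSimple (arr247 A B) :=
  ⟨rfl, by simp [Fin.forall_fin_succ, Fin.exists_fin_succ, arr247, hB]⟩

lemma firstPlaneSimple_arr249 {A B : ℂ} (hB : B ≠ 0) : FirstPlaneSimple (arr249 A B) :=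
  ⟨rfl, by simp [Fin.forall_fin_succ, Fin.exists_fin_succ, arr249, hB]⟩

lemma firstPlaneSimple_arr252 {A B : ℂ} (hB : B ≠ 0) : FirstPlaneSimple (arr252 A B) :=
  ⟨rfl, by simp [Fin.forall_fin_succ, Fin.exists_fin_succ, arr252, hB]⟩

/-- Here `v² = (r² - 1)(r² - l²)` and `w² = (s² - 1)(s² - c² l²)`. The fibre product of these
families maps to the double octic of no. 2 by squaring `l`, `r` and `s`, and to the one of no. 242
by the isogeny `exists_landen` in both factors. -/
theorem correspond_arr2_arr242 (c : ℂ) {B B' : ℂ} (hB : B ≠ 0) (hB' : B' ≠ 0) :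
    Correspond (arr2 (B * c ^ 2) B) (arr242 ((c - 1) * B') B') := by
  refine correspond_of_isPullback (firstPlaneSimple_arr2 hB) (firstPlaneSimple_arr242 hB')
    ((X 1 ^ 2 - 1) * (X 1 ^ 2 - X 0 ^ 2)) ((X 2 ^ 2 - 1) * (X 2 ^ 2 - (C c * X 0) ^ 2))
    (x := ![0, 2, 0]) (y := ![0, 0, 2]) (by norm_num) (by simp; norm_num)
    fun L _ _ _ l r s v w ht hv hw hv0 hw0 => ?_
  have hl : l ≠ 0 := ht.ne_zero 0
  have hr : r ≠ 0 := ht.ne_zero 1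
  have hs : s ≠ 0 := ht.ne_zero 2
  have hrl : r ^ 4 - l ^ 2 ≠ 0 :=
    ne_zero_of_aeval_eq ht (X 1 ^ 4 - X 0 ^ 2) ![1, 0, 0] (by simp) (by simp)
  have hsl : s ^ 4 - (algebraMap ℂ L c * l) ^ 2 ≠ 0 :=
    ne_zero_of_aeval_eq ht (X 2 ^ 4 - (C c * X 0) ^ 2) ![0, 0, 1] (by simp) (by simp)
  simp at hv hw
  obtain ⟨b, z, hz0, hz, hb⟩ := exists_landen HasRelDeriv.base hr hrl hv0 hv
  obtain ⟨b', z', hz0', hz', hb'⟩ := exists_landen (l := l) (r := s)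
    (((HasRelDeriv.const c).mul .base).congr (by ring)) hs hsl hw0 hw
  have hb1 : -algebraMap ℂ L c * l + b' + 1 ≠ 0 := by
    intro h
    refine hz0' (pow_eq_zero_iff two_ne_zero |>.1 ?_)
    rw [hz']
    linear_combination (b' ^ 2 - (algebraMap ℂ L c * l + 1) ^ 2) *
      (b' + algebraMap ℂ L c * l - 1) * h
  obtain ⟨e, rfl⟩ := IsAlgClosed.exists_pow_nat_eq B zero_lt_two
  have hI := algebraMap_I_sq (L := L)
  have he0 : algebraMap ℂ L e ≠ 0 := by simpa using hB
  have hB0 : algebraMap ℂ L B' ≠ 0 := by simpa using hB'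
  refine ⟨(v * w)⁻¹, -8 / e, -4 / B', by simp [*], by simpa using hB, by simpa using hB', ?_, ?_⟩
  · refine isPullback_of_homogeneous
      (volumeForm_of_hasRelDeriv (HasRelDeriv.fibre (r := l)).sq
        (HasRelDeriv.fibre (r := r)).sq (HasRelDeriv.fibre (r := s)).sq)
      !![1, 0, 0, 0; 0, -1, 0, 0; 0, 0, 0, 1; 0, 0, -1, 0]
      ![l ^ 2, -r ^ 2, 1, -s ^ 2] ?_ ?_ (algebraMap ℂ L e * l * r * s * v * w) ?_ ?_ ?_
    · simp [Fin.forall_fin_succ]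
    · simpa using hs
    · simp [Fin.prod_univ_eight, arr2, mul_pow, hv, hw]
      ring
    · simp [*]
    · rw [det_fin_four]; simp [map_ofNat]; field_simp; norm_num
  · refine isPullback_of_homogeneous
      (volumeForm_of_hasRelDeriv .fibre hb hb')
      !![1, 1, 0, 1; 1, -1, 0, -1; -1, -1, 0, 1; -c, 0, 1, 1]
      ![l + b + 1, l - b - 1, -l - b + 1, -algebraMap ℂ L c * l + b' + 1] ?_ ?_
      (algebraMap ℂ L B' * z * z') ?_ ?_ ?_
    · simp [Fin.forall_fin_succ, sub_eq_add_neg]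
    · simpa using hb1
    · simp [Fin.prod_univ_eight, arr242, mul_pow, hz, hz']
      ring
    · simp [*]
    · rw [det_fin_four]; simp [map_ofNat]; field_simp; linear_combination 4 * hI

/-- Both double octics come from fibre products with the factor
`w² = s (s + l) (s - 1) (2 a s + 1 - l)`; the other factors are related by the isogeny
`exists_landen`. -/
theorem correspond_arr247_arr252 {a B B' : ℂ} (ha : a ≠ 0) (ha' : 1 + 2 * a ≠ 0)
    (hB : B ≠ 0) (hB' : B' ≠ 0) :
    Correspond (arr247 (2 * a * B) B) (arr252 (a * B') B') := by
  refine correspond_of_isPullback (firstPlaneSimple_arr247 hB) (firstPlaneSimple_arr252 hB')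
    ((X 1 ^ 2 - 1) * (X 1 ^ 2 - X 0 ^ 2))
    (X 2 * (X 2 + X 0) * (X 2 - 1) * (2 * C a * X 2 + 1 - X 0))
    (x := ![0, 2, 0]) (y := ![2 * a * 2, 0, 2]) (by norm_num) (by
      have : 2 + 2 * a * 2 ≠ 0 := fun h => ha' (by linear_combination h / 2)
      simp [map_ofNat, this]; norm_num)
    fun L _ _ _ l r s v w ht hv hw hv0 hw0 => ?_
  have hr : r ≠ 0 := ht.ne_zero 1
  have hrl : r ^ 4 - l ^ 2 ≠ 0 :=
    ne_zero_of_aeval_eq ht (X 1 ^ 4 - X 0 ^ 2) ![1, 0, 0] (by simp) (by simp)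
  have hr1 : r + 1 ≠ 0 := ne_zero_of_aeval_eq ht (X 1 + 1) ![0, 0, 0] (by simp) (by simp)
  simp [map_ofNat] at hv hw
  obtain ⟨b, z, hz0, hz, hb⟩ := exists_landen HasRelDeriv.base hr hrl hv0 hv
  have hb1 : -l - b + 1 ≠ 0 := by
    intro h
    refine hz0 (pow_eq_zero_iff two_ne_zero |>.1 ?_)
    rw [hz]
    linear_combination -(b ^ 2 - (l + 1) ^ 2) * (b - l + 1) * h
  -- The product of the forms of no. 252 at the point below is `-8 a³ B'² v² w²`.
  obtain ⟨e, he⟩ := IsAlgClosed.exists_pow_nat_eq (-8 * a ^ 3 * B' ^ 2) zero_lt_two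
  obtain ⟨β, rfl⟩ := IsAlgClosed.exists_pow_nat_eq B zero_lt_two
  have hI := algebraMap_I_sq (L := L)
  have he1 : e ≠ 0 := by rintro rfl; simp_all
  have he0 : algebraMap ℂ L e ≠ 0 := by simpa using he1
  have he' : algebraMap ℂ L e ^ 2 = -8 * algebraMap ℂ L a ^ 3 * algebraMap ℂ L B' ^ 2 := by
    rw [← map_pow, he]; simp [map_ofNat]
  have hβ : algebraMap ℂ L β ≠ 0 := by simpa using hB
  refine ⟨(v * w)⁻¹, -2 / β, 4 * a / e, by simp [*], by simpa using hB, by simp [*], ?_, ?_⟩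
  · refine isPullback_of_homogeneous
      (volumeForm_of_hasRelDeriv (s := s) .fibre hb .fibre)
      !![0, 0, 2, 0; 1, 1, 0, 1; 1, -1, 0, -1; -1, -1, 0, 1]
      ![2 * s, l + b + 1, l - b - 1, -l - b + 1] ?_ ?_
      (4 * algebraMap ℂ L Complex.I * algebraMap ℂ L β * z * w) ?_ ?_ ?_
    · simp [Fin.forall_fin_succ, sub_eq_add_neg, map_ofNat]
    · simpa using hb1
    · simp [Fin.prod_univ_eight, arr247, mul_pow, hI, hz, hw, map_ofNat]
      ring
    · simp [*]
    · rw [det_fin_four]; simp [map_ofNat]; field_simp; norm_num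
  · refine isPullback_of_homogeneous (volumeForm_eq_one_smul _)
      !![0, 1, 0, -1; 1, -1, 0, 0; 0, 0, -2 * a, 0; 0, 1, 0, 1]
      ![r - 1, l - r, -2 * algebraMap ℂ L a * s, r + 1] ?_ ?_ (algebraMap ℂ L e * v * w) ?_ ?_ ?_
    · simp [Fin.forall_fin_succ, sub_eq_add_neg, map_ofNat]
    · simpa using hr1
    · simp [Fin.prod_univ_eight, arr252, mul_pow, he', hv, hw, map_ofNat]
      ring
    · simp [*]
    · rw [det_fin_four]; simp [map_ofNat]; field_simp; ring

/-- The double octic of no. 249 comes from the fibre product over the `l`-line of the families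
`v² = …` and `w² = …` defined by the two polynomials. The one of no. 8 is fibred over the line with
coordinate `y / (t - z - y) = (l - 1)² / (4 l)`, an invariant of `l ↦ 1 / l`; on the fibres, its
coordinates are `r²` and a fractional linear function of `s`. -/
theorem correspond_arr8_arr249 {e A B : ℂ} (he : e ≠ 0) (he' : 1 + e ≠ 0) (hA : A ≠ 0)
    (hB : B ≠ 0) : Correspond (arr8 (4 * e * (1 + e) * B) B) (arr249 A (e * A)) := by
  refine correspond_of_isPullback (firstPlaneSimple_arr8 hB)
    (firstPlaneSimple_arr249 (mul_ne_zero he hA))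
    ((X 1 ^ 2 - (X 0 + 1) ^ 2) * (X 1 ^ 2 - (X 0 - 1) ^ 2))
    (X 2 * (X 2 + 1) * (X 2 - (C e - (1 + C e) * X 0)) * (X 2 - C e * (1 - X 0)))
    (x := ![0, 0, 0]) (y := ![1, 0, 1]) (by simp) (by simp)
    fun L _ _ _ l r s v w ht hv hw hv0 hw0 => ?_
  have hl : l ≠ 0 := ht.ne_zero 0
  have hr : r ≠ 0 := ht.ne_zero 1
  have hs : s ≠ 0 := ht.ne_zero 2
  have hl1 : l + 1 ≠ 0 := ne_zero_of_aeval_eq ht (X 0 + 1) ![0, 0, 0] (by simp) (by simp)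
  have hl2 : 1 - l ≠ 0 := ne_zero_of_aeval_eq ht (1 - X 0) ![0, 0, 0] (by simp) (by simp)
  have hp : algebraMap ℂ L e - (1 + algebraMap ℂ L e) * l ≠ 0 :=
    ne_zero_of_aeval_eq ht (C e - (1 + C e) * X 0) ![0, 0, 0] (by simp) (by simpa using he)
  have hlr : (l + 1) ^ 2 - r ^ 2 ≠ 0 :=
    ne_zero_of_aeval_eq ht ((X 0 + 1) ^ 2 - X 1 ^ 2) ![0, 0, 0] (by simp) (by simp)
  have hlr' : -l - r + 1 ≠ 0 :=
    ne_zero_of_aeval_eq ht (-X 0 - X 1 + 1) ![0, 0, 0] (by simp) (by simp)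
  simp at hv hw
  obtain ⟨β, rfl⟩ := IsAlgClosed.exists_pow_nat_eq B zero_lt_two
  have hI := algebraMap_I_sq (L := L)
  have hI0 : algebraMap ℂ L Complex.I ≠ 0 := by simp
  have hβ : algebraMap ℂ L β ≠ 0 := by simpa using hB
  have hA0 : algebraMap ℂ L A ≠ 0 := by simpa using hA
  have he0 : algebraMap ℂ L e ≠ 0 := by simpa using he
  have he0' : 1 + algebraMap ℂ L e ≠ 0 := by
    rwa [← map_one (algebraMap ℂ L), ← map_add, map_ne_zero]
  refine ⟨(v * w)⁻¹, 4 / β, 2 / (Complex.I * A), by simp [*], by simpa using hB,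
    by simp [*], ?_, ?_⟩
  · obtain ⟨ε, hε⟩ : ∃ ε, algebraMap ℂ L e = ε := ⟨_, rfl⟩
    rw [hε] at hp hw he0 he0'
    have hεd {k x : L} : HasRelDeriv k x ε 0 := hε ▸ HasRelDeriv.const e
    have hτ : HasRelDeriv 0 l ((l - 1) ^ 2 / (4 * l)) ((l ^ 2 - 1) / (4 * l ^ 2)) :=
      ((HasRelDeriv.fibre.sub .one).sq.div ((HasRelDeriv.ofNat 4).mul .fibre)).congr
        (by field_simp; ring)
    have hz : HasRelDeriv l r (-r ^ 2 / (4 * l)) (-r / (2 * l)) :=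
      (HasRelDeriv.fibre.sq.neg.div ((HasRelDeriv.ofNat 4).mul .base)).congr
        (by field_simp; ring)
    have hx : HasRelDeriv l s (-(1 - l) * (s - (ε - (1 + ε) * l)) / (4 * (1 + ε) * l * s))
        (-(1 - l) * (ε - (1 + ε) * l) / (4 * (1 + ε) * l * s ^ 2)) :=
      (((HasRelDeriv.one.sub .base).neg.mul (HasRelDeriv.fibre.sub
        (hεd.sub ((HasRelDeriv.one.add hεd).mul .base)))).div
        ((((HasRelDeriv.ofNat 4).mul (HasRelDeriv.one.add hεd)).mul .base).mul .fibre)).congr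
        (by field_simp; ring)
    refine isPullback_of_homogeneous (volumeForm_of_hasRelDeriv hτ hz hx)
      !![0, 0, 1, 0; 1, 0, 0, 0; 0, 1, 0, 0; 1, 1, 0, 1]
      ![-(1 - l) * (s - (ε - (1 + ε) * l)) / (4 * (1 + ε) * l * s), (l - 1) ^ 2 / (4 * l),
        -r ^ 2 / (4 * l), ((l + 1) ^ 2 - r ^ 2) / (4 * l)] ?_ ?_
      (algebraMap ℂ L β * (1 - l) * (ε - (1 + ε) * l) * (l ^ 2 - 1) * r * v * w /
        (128 * (1 + ε) * l ^ 4 * s ^ 2)) ?_ ?_ ?_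
    · simp [Fin.forall_fin_succ]
      field_simp
      ring
    · simp [*]
    · simp [Fin.prod_univ_eight, arr8, hε, mul_pow, div_pow, hv, hw, map_ofNat]
      field_simp
      ring
    · have : l ^ 2 - 1 ≠ 0 := by
        rw [show l ^ 2 - 1 = -((l + 1) * (1 - l)) by ring]; simp [*]
      simp [*]
    · rw [det_fin_four]; simp [map_ofNat]; field_simp; ring
  · refine isPullback_of_homogeneous (volumeForm_eq_one_smul _)
      !![1, 1, 0, 1; 1, -1, 0, -1; -1, -1, 0, 1; 0, 0, 2, 0]
      ![l + r + 1, l - r - 1, -l - r + 1, 2 * s] ?_ ?_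
      (4 * algebraMap ℂ L Complex.I * algebraMap ℂ L A * v * w) ?_ ?_ ?_
    · simp [Fin.forall_fin_succ, sub_eq_add_neg, map_ofNat]
    · simpa using hs
    · simp [Fin.prod_univ_eight, arr249, mul_pow, hI, hv, hw]
      ring
    · simp [*]
    · rw [det_fin_four]; simp [map_ofNat]; field_simp; ring

/-- The product of the eight forms of arrangement no. 10 in coordinates on the base (`σ`) and the
two fibres (`Y` and `T`): up to squares it is `Y (Y - 1) (Y + σ) · T (T - 1) (T + σ)` times
`β (α σ - 1)`, where `(α β : β)` is the parameter. -/
lemma arr10_product {K : Type*} [Field K] {α β σ Y T : K} (h : Y - α * σ ≠ 0) :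
    let x := σ * (α * σ - 1) / (Y - α * σ)
    let y := α * σ - 1 + α * x
    x * y * T * (x + y) * (y + 1) * (1 - T) * (α * β * x - β * y - β - α * β * T) =
      α ^ 2 * β * (α * σ - 1) ^ 3 * σ ^ 2 / (Y - α * σ) ^ 4 *
        (Y * (Y - 1) * (Y + σ)) * (T * (T - 1) * (T + σ)) := by
  intro x y
  obtain ⟨D, rfl⟩ : ∃ D, Y = D + α * σ := ⟨Y - α * σ, by ring⟩
  simp only [add_sub_cancel_right, x, y] at h ⊢
  field_simp
  ring

/-- The substitution `Y = (l + c)(r - l) / (c r)` carries `r (r - 1) (r - l) (r - l - c)` to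
`Y (Y - 1) (Y + σ)`, up to a square. -/
lemma arr10_fibre {K : Type*} [Field K] {l c r v Y : K} (hc : c ≠ 0) (hr : r ≠ 0)
    (hv : v ^ 2 = r * (r - 1) * (r - l) * (r - l - c)) (hY : Y = (l + c) * (r - l) / (c * r)) :
    Y * (Y - 1) * (Y + (l - 1) * (l + c) / c) = (l * (l + c)) ^ 2 * v ^ 2 / (c ^ 3 * r ^ 4) := by
  rw [hv, hY]
  field_simp
  ring

/-- The square root of the product in `arr10_product`, once `α σ - 1` is minus a square. -/
lemma arr10_sq {K : Type*} [Field K] {i α β h σ Y T m c r s v w : K} (hi : i ^ 2 = -1)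
    (hh : α * σ - 1 = -h ^ 2) (hD : Y - α * σ ≠ 0)
    (hY : Y * (Y - 1) * (Y + σ) = m ^ 2 * v ^ 2 / (c ^ 3 * r ^ 4))
    (hT : T * (T - 1) * (T + σ) = m ^ 2 * w ^ 2 / (c ^ 3 * s ^ 4)) :
    let x := σ * (α * σ - 1) / (Y - α * σ)
    let y := α * σ - 1 + α * x
    (i * α * β * h ^ 3 * σ * m ^ 2 * v * w / ((Y - α * σ) ^ 2 * c ^ 3 * r ^ 2 * s ^ 2)) ^ 2 =
      x * y * T * (x + y) * (y + 1) * (1 - T) *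
        (α * β ^ 2 * x - β ^ 2 * y - β ^ 2 - α * β ^ 2 * T) := by
  intro x y
  rw [arr10_product hD, hY, hT, hh]
  generalize Y - α * σ = D
  linear_combination (α ^ 2 * β ^ 2 * h ^ 6 * σ ^ 2 * m ^ 4 * v ^ 2 * w ^ 2 /
    (D ^ 4 * c ^ 6 * r ^ 4 * s ^ 4)) * hi

/-- Both factors for no. 242 are `v² = r (r - 1) (r - l) (r - l - c)`; the factors for no. 10 are
twists of `Y (Y - 1) (Y + σ)`, to which the former is carried by a projective change of coordinate
if `σ = (l - 1) (l + c) / c`. The value of `a` is the one for which the leftover factor `a σ - 1`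
becomes, up to sign, the square of `(2 l + c - 1) / (c + 1)`. -/
theorem correspond_arr10_arr242 {a c B B' : ℂ} (hc : c ≠ 0) (hc1 : c + 1 ≠ 0)
    (ha : a = -4 * c / (c + 1) ^ 2) (hB : B ≠ 0) (hB' : B' ≠ 0) :
    Correspond (arr10 (a * B) B) (arr242 ((c - 1) * B') B') := by
  refine correspond_of_isPullback (firstPlaneSimple_arr10 hB) (firstPlaneSimple_arr242 hB')
    (X 1 * (X 1 - 1) * (X 1 - X 0) * (X 1 - X 0 - C c))
    (X 2 * (X 2 - 1) * (X 2 - X 0) * (X 2 - X 0 - C c))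
    (x := ![2 + c, 2, 0]) (y := ![2 + c, 0, 2])
    (by simp [hc]; exact ⟨by norm_num, fun h => hc (by linear_combination -h / 2)⟩)
    (by simp [hc]; exact ⟨by norm_num, fun h => hc (by linear_combination -h / 2)⟩)
    fun L _ _ _ l r s v w ht hv hw hv0 hw0 => ?_
  have hl : l ≠ 0 := ht.ne_zero 0
  have hr : r ≠ 0 := ht.ne_zero 1
  have hs : s ≠ 0 := ht.ne_zero 2
  have hl1 : l - 1 ≠ 0 := ne_zero_of_aeval_eq ht (X 0 - 1) ![0, 0, 0] (by simp) (by simp)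
  have hsl : s - l ≠ 0 := ne_zero_of_aeval_eq ht (X 2 - X 0) ![0, 0, 1] (by simp) (by simp)
  have hls : l - s ≠ 0 := sub_ne_zero.2 (sub_ne_zero.1 hsl).symm
  simp at hv hw
  have hl2 : l + algebraMap ℂ L c ≠ 0 :=
    ne_zero_of_aeval_eq ht (X 0 + C c) ![0, 0, 0] (by simp) (by simpa using hc)
  have hh : 2 * l + algebraMap ℂ L c - 1 ≠ 0 :=
    ne_zero_of_aeval_eq ht (2 * X 0 + C c - 1) ![-c / 2, 0, 0] (by simp [map_ofNat])
      (by simp; ring_nf; simp)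
  have hD : r - l - algebraMap ℂ L a * r * (l - 1) ≠ 0 :=
    ne_zero_of_aeval_eq ht (X 1 - X 0 - C a * X 1 * (X 0 - 1)) ![1, 0, 0] (by simp) (by simp)
  obtain ⟨β, rfl⟩ := IsAlgClosed.exists_pow_nat_eq B zero_lt_two
  have ha0 : a ≠ 0 := by rw [ha]; simp [hc, hc1]
  have hI := algebraMap_I_sq (L := L)
  have hI0 : algebraMap ℂ L Complex.I ≠ 0 := by simp
  have hβ : algebraMap ℂ L β ≠ 0 := by simpa using hB
  have hB0 : algebraMap ℂ L B' ≠ 0 := by simpa using hB'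
  have hα0 : algebraMap ℂ L a ≠ 0 := by simpa using ha0
  refine ⟨(v * w)⁻¹, (c + 1) / (Complex.I * β), -1 / B', by simp [*],
    by simp_all, by simp [*], ?_, ?_⟩
  · have hα : algebraMap ℂ L a = -4 * algebraMap ℂ L c / (algebraMap ℂ L c + 1) ^ 2 := by
      rw [ha]; simp [map_ofNat]
    have hγ1 : algebraMap ℂ L c + 1 ≠ 0 := by
      rwa [← map_one (algebraMap ℂ L), ← map_add, map_ne_zero]
    have hγ0 : algebraMap ℂ L c ≠ 0 := by simpa using hc
    obtain ⟨γ, hγ⟩ : ∃ γ, algebraMap ℂ L c = γ := ⟨_, rfl⟩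
    obtain ⟨α, hα'⟩ : ∃ α, algebraMap ℂ L a = α := ⟨_, rfl⟩
    rw [hγ] at hv hw hl2 hh hα hγ1 hγ0
    rw [hα'] at hα hα0 hD
    have hγd {k x : L} : HasRelDeriv k x γ 0 := hγ ▸ HasRelDeriv.const c
    have hαd {k x : L} : HasRelDeriv k x α 0 := hα' ▸ HasRelDeriv.const a
    have hY := arr10_fibre hγ0 hr hv rfl
    have hT := arr10_fibre hγ0 hs hw rfl
    have hσd : HasRelDeriv 0 l ((l - 1) * (l + γ) / γ) ((2 * l + γ - 1) / γ) :=
      (((HasRelDeriv.fibre.sub .one).mul (HasRelDeriv.fibre.add hγd)).div hγd).congr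
        (by field_simp; ring)
    have hσd' {x : L} : HasRelDeriv l x ((l - 1) * (l + γ) / γ) 0 :=
      (((HasRelDeriv.base.sub .one).mul (HasRelDeriv.base.add hγd)).div hγd).congr (by ring)
    have hYd {x : L} (hx : x ≠ 0) : HasRelDeriv l x ((l + γ) * (x - l) / (γ * x))
        (l * (l + γ) / (γ * x ^ 2)) :=
      (((HasRelDeriv.base.add hγd).mul (HasRelDeriv.fibre.sub .base)).div (hγd.mul .fibre)).congr
        (by field_simp; ring)
    have hΛ : α * ((l - 1) * (l + γ) / γ) - 1 = -((2 * l + γ - 1) / (γ + 1)) ^ 2 := by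
      rw [hα]; field_simp; ring
    clear hα
    have hT0 : (l + γ) * (s - l) / (γ * s) ≠ 0 := by simp [*]
    have hσ0 : (l - 1) * (l + γ) / γ ≠ 0 := by simp [*]
    have hD' : (l + γ) * (r - l) / (γ * r) - α * ((l - 1) * (l + γ) / γ) ≠ 0 := by
      rw [show (l + γ) * (r - l) / (γ * r) - α * ((l - 1) * (l + γ) / γ) =
        (l + γ) * (r - l - α * r * (l - 1)) / (γ * r) by field_simp]
      simp [*]
    have hYr := hYd hr
    have hTs := hYd hs
    clear hYd hD
    set Y := (l + γ) * (r - l) / (γ * r)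
    set T := (l + γ) * (s - l) / (γ * s)
    set σ := (l - 1) * (l + γ) / γ
    have hbd : HasRelDeriv l r (σ * (α * σ - 1) / (Y - α * σ))
        (-(σ * (α * σ - 1) * (l * (l + γ) / (γ * r ^ 2))) / (Y - α * σ) ^ 2) :=
      ((hσd'.mul ((hαd.mul hσd').sub .one)).div (hYr.sub (hαd.mul hσd'))).congr (by ring)
    refine isPullback_of_homogeneous (volumeForm_of_hasRelDeriv hσd hbd hTs)
      !![0, 1, 0, 0; a, a, 0, -1; 0, 0, 0, 1; 0, 0, 1, 0]
      ![σ * (α * σ - 1) / (Y - α * σ), α * σ - 1 + α * (σ * (α * σ - 1) / (Y - α * σ)), 1, T]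
      ?_ ?_
      (algebraMap ℂ L Complex.I * α * algebraMap ℂ L β * ((2 * l + γ - 1) / (γ + 1)) ^ 3 * σ *
        (l * (l + γ)) ^ 2 * v * w / ((Y - α * σ) ^ 2 * γ ^ 3 * r ^ 2 * s ^ 2)) ?_ ?_ ?_
    · simp [Fin.forall_fin_succ, hα']
      ring
    · simpa using hT0
    · rw [arr10_sq hI hΛ hD' hY hT]
      generalize σ * (α * σ - 1) / (Y - α * σ) = x
      generalize α * σ - 1 + α * x = y
      simp [Fin.prod_univ_eight, arr10, hα']
      ring
    · simp [*]
    · rw [det_fin_four, hΛ]; simp [hα', hγ]; field_simp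
  · refine isPullback_of_homogeneous (volumeForm_eq_one_smul _)
      !![0, 1, 0, 0; 0, -1, 0, 1; 0, 0, -1, 0; 1, 0, -1, 0]
      ![r, 1 - r, -s, l - s] ?_ ?_ (algebraMap ℂ L B' * v * w) ?_ ?_ ?_
    · simp [Fin.forall_fin_succ, sub_eq_add_neg, add_comm]
    · simpa using hls
    · simp [Fin.prod_univ_eight, arr242, mul_pow, hv, hw]
      ring
    · simp [*]
    · rw [det_fin_four]; simp; field_simp

end Families

/-! ### Parameters of corresponding members -/

section Parameters

theorem familiesCorrespond_2_242 : FamiliesCorrespond nonspecial2 arr2 nonspecial242 arr242 := by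
  constructor
  · rintro A B ⟨hB, hA, hAB⟩
    obtain ⟨c, hc⟩ := IsAlgClosed.exists_pow_nat_eq (A / B) zero_lt_two
    obtain rfl : A = B * c ^ 2 := by rw [hc]; field_simp
    have hc0 : c ≠ 0 := by rintro rfl; simp at hA
    refine ⟨(c - 1) * 1, 1, ⟨one_ne_zero, fun h => hAB ?_, fun h => hc0 ?_, fun h => hAB ?_⟩,
      correspond_arr2_arr242 c hB one_ne_zero⟩
    · linear_combination B * (c + 1) * h
    · linear_combination h
    · linear_combination B * (c - 1) * h
  · rintro A B ⟨hB, hA, hAB, hAB'⟩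
    have e : ((A + B) / B - 1) * B = A := by field_simp; ring
    have h := correspond_arr2_arr242 ((A + B) / B) one_ne_zero hB
    rw [e] at h
    refine ⟨_, 1, ⟨one_ne_zero, ?_, fun h => ?_⟩, h⟩
    · have : A + B ≠ 0 := fun h => hAB (by linear_combination h)
      simp [*]
    · field_simp at h
      have : A * (A + 2 * B) = 0 := by linear_combination h
      rcases mul_eq_zero.1 this with h | h
      · exact hA h
      · exact hAB' (by linear_combination h)

theorem familiesCorrespond_8_249 : FamiliesCorrespond nonspecial8 arr8 nonspecial249 arr249 := by
  constructor
  · rintro A B ⟨hB, hA, hAB⟩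
    -- The equation `4 e (1 + e) = A / B` reads `(2 e + 1)² = 1 + A / B`.
    obtain ⟨d, hd⟩ := IsAlgClosed.exists_pow_nat_eq (1 + A / B) zero_lt_two
    obtain ⟨e, rfl⟩ : ∃ e, d = 2 * e + 1 := ⟨(d - 1) / 2, by ring⟩
    obtain rfl : A = 4 * e * (1 + e) * B := by
      rw [← sub_eq_iff_eq_add'] at hd
      rw [← div_eq_iff hB]
      linear_combination -hd
    simp only [ne_eq, mul_eq_zero, not_or] at hA
    refine ⟨1, e * 1, ⟨by simpa using hA.1.1.2, one_ne_zero, fun h => hA.1.2 ?_, fun h => hAB ?_⟩,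
      correspond_arr8_arr249 hA.1.1.2 hA.1.2 one_ne_zero hB⟩
    · linear_combination h
    · linear_combination (1 + 2 * e) * B * h
  · rintro A B ⟨hB, hA, hAB, hAB'⟩
    have h1 : 1 + B / A ≠ 0 := fun h => hAB (by field_simp at h; linear_combination h)
    have h := correspond_arr8_arr249 (div_ne_zero hB hA) h1 hA one_ne_zero
    rw [div_mul_cancel₀ _ hA] at h
    refine ⟨_, 1, ⟨one_ne_zero, by simp [*], fun h => hAB' ?_⟩, h⟩
    field_simp at h
    have : (A + 2 * B) ^ 2 = 0 := by linear_combination h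
    linear_combination (pow_eq_zero_iff two_ne_zero).1 this

theorem familiesCorrespond_10_242 :
    FamiliesCorrespond nonspecial10 arr10 nonspecial242 arr242 := by
  constructor
  · rintro A B ⟨hB, hA, hAB⟩
    -- The equation `A / B = -4 c / (c + 1)²` says that `1 + A / B` is the square of
    -- `d = (c - 1) / (c + 1)`.
    obtain ⟨d, hd⟩ := IsAlgClosed.exists_pow_nat_eq (1 + A / B) zero_lt_two
    obtain rfl : A = (d ^ 2 - 1) * B := by rw [hd]; field_simp; ring
    have hd1 : 1 - d ≠ 0 := fun h => hA (by linear_combination -B * (d + 1) * h)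
    have hd2 : 1 + d ≠ 0 := fun h => hA (by linear_combination B * (d - 1) * h)
    have hd0 : d ≠ 0 := by rintro rfl; exact hAB (by ring)
    have hc : (1 + d) / (1 - d) + 1 = 2 / (1 - d) := by field_simp; ring
    refine ⟨((1 + d) / (1 - d) - 1) * 1, 1, ⟨one_ne_zero, fun h => hd0 ?_, fun h => hd2 ?_,
      fun h => ?_⟩, correspond_arr10_arr242 (div_ne_zero hd2 hd1) ?_ ?_ hB one_ne_zero⟩
    · field_simp at h
      linear_combination h / 2
    · field_simp at h
      linear_combination h
    · field_simp at h
      exact two_ne_zero (α := ℂ) (by linear_combination h)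
    · simp [hc, hd1]
    · rw [hc]; field_simp; ring
  · rintro A B ⟨hB, hA, hAB, hAB'⟩
    have e : ((A + B) / B - 1) * B = A := by field_simp; ring
    have h0 : A + B ≠ 0 := fun h => hAB (by linear_combination h)
    have h1 : A + B + B ≠ 0 := fun h => hAB' (by linear_combination h)
    have hc : (A + B) / B + 1 = (A + B + B) / B := by field_simp
    have h := correspond_arr10_arr242 (div_ne_zero h0 hB) (by simp [*]) rfl one_ne_zero hB
    rw [e] at h
    refine ⟨_, 1, ⟨one_ne_zero, by simp [*], fun h => hA ?_⟩, h⟩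
    rw [hc] at h
    field_simp at h
    have : A ^ 2 = 0 := by linear_combination h
    exact (pow_eq_zero_iff two_ne_zero).1 this

theorem familiesCorrespond_247_252 :
    FamiliesCorrespond nonspecial247 arr247 nonspecial252 arr252 := by
  constructor
  · rintro A B ⟨hB, hA, hAB, hAB'⟩
    obtain ⟨a, rfl⟩ : ∃ a, A = 2 * a * B := ⟨A / (2 * B), by field_simp⟩
    have ha : a ≠ 0 := by rintro rfl; simp at hA
    have ha' : 1 + 2 * a ≠ 0 := fun h => hAB (by linear_combination B * h)
    refine ⟨a * 1, 1, ⟨one_ne_zero, by simpa using ha, fun h => hAB' ?_, fun h => ha' ?_⟩,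
      correspond_arr247_arr252 ha ha' hB one_ne_zero⟩
    · linear_combination 2 * B * h
    · linear_combination h
  · rintro A B ⟨hB, hA, hAB, hAB'⟩
    have h1 : 1 + 2 * (A / B) ≠ 0 := fun h => hAB' (by field_simp at h; linear_combination h)
    have h := correspond_arr247_arr252 (div_ne_zero hA hB) h1 one_ne_zero hB
    rw [div_mul_cancel₀ _ hB] at h
    refine ⟨_, 1, ⟨one_ne_zero, by simp [*], fun h => h1 ?_, fun h => hAB ?_⟩, h⟩
    · linear_combination h
    · field_simp at h
      exact h

end Parameters

end DoubleOctic

end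

open DoubleOctic in
theorem mainTheorem4 :
    Correspond arr1 arr238 ∧
    Correspond arr32 arr93 ∧
    Correspond arr238 arr241 ∧
    Correspond arr240 arr245 ∧
    FamiliesCorrespond nonspecial2 arr2 nonspecial242 arr242 ∧
    FamiliesCorrespond nonspecial8 arr8 nonspecial249 arr249 ∧
    FamiliesCorrespond nonspecial10 arr10 nonspecial242 arr242 ∧
    FamiliesCorrespond nonspecial247 arr247 nonspecial252 arr252 :=
  ⟨correspond_arr1_arr238, correspond_arr32_arr93, correspond_arr238_arr241,
    correspond_arr240_arr245, familiesCorrespond_2_242, familiesCorrespond_8_249,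
    familiesCorrespond_10_242, familiesCorrespond_247_252⟩
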